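/- For $\tau$ in the upper half-plane $\mathbb H^2$ let $\mathbb T_\tau=\mathbb C/(\mathbb Z\tau+\mathbb Z)$ be the flat torus of modulus $\tau$, and let $$\mathcal M_{\mathrm{short}}^+=\{\tau=\tau_1+i\tau_i\in\mathbb H^2 : |\tau|\ge 1,\ |\tau_1|\le \tfrac12,\ |\tau_i|\le 33,\ \tau_1\ge 0\}.$$ For integers $n,d$ and real $a,h$, put $A_k=(e^{2\pi i k/n},0)$ and $B_k=(e^{i\pi(a+1+2k)/n},h)$ in $\mathbb C\times\mathbb R=\mathbb E^3$ (indices modulo $n$). The diplotorus $\mathcal D_{n,d}^{a,h}$ is the union of the triangles $A_kA_{k+1}B_k$, $B_kA_{k+1}B_{k+1}$, $A_kA_{k+1}B_{k-d}$ and $B_{k-d}A_{k+1}B_{k+1-d}$ for $0\le k<n$. The parameters are admissible if $h>0$, $n>4$, $2\le|d|<n-2$, and $d+1<a<n-1$ when $d>0$, $1-n<a<d-1$ when $d<0$. Its modulus is $\tau(n,d,a,h)=\tau_1(n,d,a)+i\,\tau_i(n,d,a,h)$, where $$\tau_1(n,d,a)=\frac dn-\frac{\cos((a-d)\frac\pi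 n)\,\sin(d\frac\pi n)}{n\sin\frac\pi n},$$ $$\tau_i(n,d,a,h)=\frac{\sqrt{h^2+4\sin^2(\frac{a+1}2\cdot\frac\pi n)\sin^2(\frac{a-1}2\cdot\frac\pi n)}+\sqrt{h^2+4\sin^2(\frac{a-2d+1}2\cdot\frac\pi n)\sin^2(\frac{a-2d-1}2\cdot\frac\pi n)}}{2n\sin\frac\pi n}.$$ **Lemma.** Every modulus in $\mathcal M_{\mathrm{short}}^+$ is geometrically realized by a diplotorus with $n=19$ and $d\in\{2,7,13\}$. That is, for every $\tau\in\mathcal M_{\mathrm{short}}^+$ there are $d\in\{2,7,13\}$ and $a,h\in\mathbb R$ such that $(19,d,a,h)$ is admissible and 1. $\tau(19,d,a,h)=g\cdot\tau$ for some $g\in \mathrm{SL}_2(\mathbb Z)$; 2. after rescaling its metric by a positive constant, $\mathbb T_\tau$ has a piecewise linear isometric embedding into $\mathbb E^3$ with image $\mathcal D_{19,d}^{a,h}$. More precisely, there are a triangulation of $\mathbb T_\tau$ and a topological embedding of $\mathbb T_\tau$ into $\mathbb E^3$ with image $\mathcal D_{19,d}^{a,h}$ that maps the triangles of the triangulation,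 one-to-one and each of them isometrically for the rescaled metric, onto the triangles of the diplotorus listed above. -/

import Mathlib

open scoped UpperHalfPlane MatrixGroups

namespace Diplotorus

noncomputable section

/-- Euclidean 3-space. -/
abbrev E3 : Type := EuclideanSpace ℝ (Fin 3)

/-- The lattice `ℤ τ + ℤ` in the Euclidean plane `ℂ`. -/
def lattice (τ : ℍ) : AddSubgroup ℂ := AddSubgroup.closure {1, (τ : ℂ)}

/-- The flat torus `ℂ / (ℤ τ + ℤ)` of modulus `τ`. It carries the quotient topology, and `dist` on
it is Mathlib's quotient distance, i.e. the infimum of the Euclidean distances between lifts: this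
is the flat (polyhedral) metric of the torus. -/
abbrev FlatTorus (τ : ℍ) : Type := ℂ ⧸ lattice τ

/-- The projection of the plane onto the flat torus. -/
def proj (τ : ℍ) (z : ℂ) : FlatTorus τ := QuotientAddGroup.mk z

/-- A Euclidean triangle in the flat torus of modulus `τ`: a nondegenerate triangle of the plane
that projects injectively to the torus. -/
structure FlatTriangle (τ : ℍ) where
  vertex : Fin 3 → ℂ
  indep : AffineIndependent ℝ vertex
  inj : Set.InjOn (proj τ) (convexHull ℝ (Set.range vertex))

namespace FlatTriangle

variable {τ : ℍ}

/-- The face (empty, vertex, side, or whole triangle) spanned by the vertices with index in `s`,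
as a subset of the torus. -/
def face (T : FlatTriangle τ) (s : Set (Fin 3)) : Set (FlatTorus τ) :=
  proj τ '' convexHull ℝ (T.vertex '' s)

/-- The closed triangle, as a subset of the torus. -/
def carrier (T : FlatTriangle τ) : Set (FlatTorus τ) := T.face Set.univ

/-- The set of the three vertices, in the torus. -/
def vertexSet (T : FlatTriangle τ) : Set (FlatTorus τ) := Set.range (fun i => proj τ (T.vertex i))

end FlatTriangle

/-- A finite family of triangles is a triangulation of the flat torus if it covers the torus and
two distinct members meet in a common proper face (possibly empty). -/
structure IsTriangulation {τ : ℍ} {ι : Type} (T : ι → FlatTriangle τ) : Prop where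
  finite : Finite ι
  cover : ⋃ i, (T i).carrier = Set.univ
  inter : ∀ i j, i ≠ j → ∃ s t : Set (Fin 3), s ≠ Set.univ ∧ t ≠ Set.univ ∧
    (T i).carrier ∩ (T j).carrier = (T i).face s ∧
    (T i).carrier ∩ (T j).carrier = (T j).face t

/-- `f` multiplies distances by `c` on every triangle of the family `T`. For `c = 1` it is
distance preserving on each triangle; in general it is so for the metric of the torus rescaled
by `c`. -/
def IsPiecewiseSimilarity {τ : ℍ} {ι : Type} (T : ι → FlatTriangle τ) (c : ℝ)
    (f : FlatTorus τ → E3) : Prop :=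
  ∀ i, ∀ x ∈ (T i).carrier, ∀ y ∈ (T i).carrier, dist (f x) (f y) = c * dist x y

/-- The polyhedron in `E3` that is the union of the triangles whose sets of vertices are
the members of `𝒯`. -/
def polyhedron (𝒯 : Set (Set E3)) : Set E3 := ⋃ t ∈ 𝒯, convexHull ℝ t

/-- The modulus `τ` is geometrically realized by the triangulated polyhedron `𝒯`: after rescaling
the metric by some `c > 0`, the flat torus of modulus `τ` has a piecewise linear isometric
embedding `f` onto the polyhedron, where `f` maps the triangles of some triangulation of the torus,
bijectively, each one isometrically onto the corresponding triangle of `𝒯`. -/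
def IsRealizedBy (τ : ℍ) (𝒯 : Set (Set E3)) : Prop :=
  ∃ (c : ℝ) (f : FlatTorus τ → E3) (T : 𝒯 → FlatTriangle τ),
    0 < c ∧ Topology.IsEmbedding f ∧ Set.range f = polyhedron 𝒯 ∧
    IsTriangulation T ∧ IsPiecewiseSimilarity T c f ∧
    ∀ t : 𝒯, f '' (T t).vertexSet = (t : Set E3) ∧ f '' (T t).carrier = convexHull ℝ (t : Set E3)

/-- The vertex `A_k = (e^{2πik/n}, 0)`. It depends only on `k` modulo `n`. -/
def vertexA (n k : ℤ) : E3 :=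
  !₂[Real.cos (2 * Real.pi * k / n), Real.sin (2 * Real.pi * k / n), 0]

/-- The vertex `B_k = (e^{iπ(a+1+2k)/n}, h)`. It depends only on `k` modulo `n`. -/
def vertexB (n : ℤ) (a h : ℝ) (k : ℤ) : E3 :=
  !₂[Real.cos (Real.pi / n * (a + 1 + 2 * k)), Real.sin (Real.pi / n * (a + 1 + 2 * k)), h]

/-- The triangles of the internal ploid, given by their sets of vertices. -/
def ploidInt (n : ℤ) (a h : ℝ) : Set (Set E3) :=
  {t | ∃ k : ℤ, 0 ≤ k ∧ k < n ∧
    (t = {vertexA n k, vertexA n (k + 1), vertexB n a h k} ∨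
     t = {vertexB n a h k, vertexA n (k + 1), vertexB n a h (k + 1)})}

/-- The triangles of the external ploid, given by their sets of vertices. -/
def ploidExt (n d : ℤ) (a h : ℝ) : Set (Set E3) :=
  {t | ∃ k : ℤ, 0 ≤ k ∧ k < n ∧
    (t = {vertexA n k, vertexA n (k + 1), vertexB n a h (k - d)} ∨
     t = {vertexB n a h (k - d), vertexA n (k + 1), vertexB n a h (k + 1 - d)})}

/-- The diplotorus with parameters `n, d, a, h`, as a set of triangles. -/
def diplotorus (n d : ℤ) (a h : ℝ) : Set (Set E3) := ploidInt n a h ∪ ploidExt n d a h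

/-- The range of parameters for which the diplotorus is considered. -/
def Admissible (n d : ℤ) (a h : ℝ) : Prop :=
  0 < h ∧ 4 < n ∧ 2 ≤ |d| ∧ |d| < n - 2 ∧
  (0 < d → (d : ℝ) + 1 < a ∧ a < n - 1) ∧
  (d < 0 → 1 - (n : ℝ) < a ∧ a < d - 1)

/-- Real part `τ₁(n,d,a)` of the modulus of the diplotorus, by its closed formula. -/
def modulusRe (n d : ℤ) (a : ℝ) : ℝ :=
  d / n - Real.cos ((a - d) * (Real.pi / n)) * Real.sin (d * (Real.pi / n)) /
    (n * Real.sin (Real.pi / n))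

/-- Imaginary part `τ_i(n,d,a,h)` of the modulus of the diplotorus, by its closed formula. -/
def modulusIm (n d : ℤ) (a h : ℝ) : ℝ :=
  (√(h ^ 2 + 4 * Real.sin ((a + 1) / 2 * (Real.pi / n)) ^ 2 *
        Real.sin ((a - 1) / 2 * (Real.pi / n)) ^ 2) +
    √(h ^ 2 + 4 * Real.sin ((a - 2 * d + 1) / 2 * (Real.pi / n)) ^ 2 *
        Real.sin ((a - 2 * d - 1) / 2 * (Real.pi / n)) ^ 2)) /
    (2 * n * Real.sin (Real.pi / n))

/-- The part with nonnegative real part of the set of moduli of short tori. -/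
def shortModuliPos : Set ℍ :=
  {τ | 1 ≤ ‖(τ : ℂ)‖ ∧ |τ.re| ≤ 1 / 2 ∧ |τ.im| ≤ 33 ∧ 0 ≤ τ.re}

end

end Diplotorus

namespace Diplotorus

noncomputable section

/-! The proof develops the diplotorus into the plane, proves that the surface has no
self-intersections, and then finds parameters with the required modulus.

Development. The universal cover of the surface is the standard triangulation of `ℤ × ℤ`, even rows
carrying the `A_k` and odd rows the `B_k` (`surfaceVertex`), and `deckGroup` acts by translations.
All horizontal edges have length 2 sin(π/n), so each ploid unrolls to a straight strip, and the same
triangulation is drawn in ℂ with triangles similar to those of the surface (`developedVertex`,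
`dist_developedVertex`). There the deck group acts by the translations of a lattice whose period
ratio is the closed formula for the modulus (`offset_period`). The lattices of τ and of g • τ differ
by a complex factor (`mem_lattice_iff_smul`), so the piecewise similarity from the plane to the
surface descends to the torus of modulus τ. By `isRealizedBy_of_periodic` it is an embedding of the
required kind as soon as the only identifications are those of the deck group.

Embeddedness. At height t h a ploid consists of the points (1 - t) A(X) + t B(Y), where A and B
parametrize the two polygons and (X, Y) runs along a staircase X - Y ∈ [δ, δ + 1], with δ = 0 inside
and δ = d outside. A coincidence makes a chord of the first polygon parallel to a chord of the
second. The direction of a chord is confined by the floors and ceilings of its endpoints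
(`exists_polygon_sub_eq`), which yields δ + δ' ≤ a + 1 + N n ≤ δ + δ' + 2 for an integer N.
Admissibility excludes this, except for N = 0 and δ = δ' = d, and there monotonicity of the
staircase makes N odd (`stair_injective`).

Parameters. For fixed n and d the real part of the modulus determines a through an arccosine, and
increasing h moves the imaginary part continuously from its value at h = 0 to infinity. The
reachable moduli thus contain the part of a vertical strip above a line and a circular arc
(`exists_parameters`). For n = 19 and d = 2, 7, 13 these regions cover the short moduli with real
part at least 0.003. The remaining thin strip along the imaginary axis is moved into them by z ↦
-1/(z - 1) when the imaginary part is at most 17, and by z ↦ -1/(z - 4) above that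
(`exists_admissible_of_mem`). -/

/-! ### Piecewise linear maps on the standard triangulation of the plane. -/

/-- A lattice point of the plane, as a point with real coordinates. -/
def toPlane (v : ℤ × ℤ) : ℝ × ℝ := (v.1, v.2)

/-- The vertices of a triangle of the standard triangulation of the plane with vertex set `ℤ × ℤ`:
the corner `v` and its two neighbours in the directions `ε (1, 0)` and `ε (0, 1)`. -/
def latticeTriangle (v : ℤ × ℤ) (ε : ℤˣ) : Fin 3 → ℤ × ℤ :=
  ![v, (v.1 + ε, v.2), (v.1, v.2 + ε)]

/-- The combination of the points `v i` with weights `w i`. -/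
def comb {E : Type*} [AddCommGroup E] [Module ℝ E] (v : Fin 3 → E) (w : Fin 3 → ℝ) : E :=
  ∑ i, w i • v i

/-- The piecewise linear extension to the plane of a map given on `ℤ × ℤ`, with respect to the
standard triangulation. -/
def interp {E : Type*} [AddCommGroup E] [Module ℝ E] (V : ℤ × ℤ → E) (p : ℝ × ℝ) : E :=
  if Int.fract p.1 + Int.fract p.2 ≤ 1 then
    (1 - Int.fract p.1 - Int.fract p.2) • V (⌊p.1⌋, ⌊p.2⌋) + Int.fract p.1 • V (⌊p.1⌋ + 1, ⌊p.2⌋) +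
      Int.fract p.2 • V (⌊p.1⌋, ⌊p.2⌋ + 1)
  else
    (Int.fract p.1 + Int.fract p.2 - 1) • V (⌊p.1⌋ + 1, ⌊p.2⌋ + 1) +
      (1 - Int.fract p.1) • V (⌊p.1⌋, ⌊p.2⌋ + 1) + (1 - Int.fract p.2) • V (⌊p.1⌋ + 1, ⌊p.2⌋)

section Interp

variable {E : Type*} [AddCommGroup E] [Module ℝ E] (V : ℤ × ℤ → E)

lemma floor_fract_add {i : ℤ} {α : ℝ} (h0 : 0 ≤ α) (h1 : α < 1) :
    ⌊(i : ℝ) + α⌋ = i ∧ Int.fract ((i : ℝ) + α) = α := by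
  have h : ⌊(i : ℝ) + α⌋ = i := by
    rw [Int.floor_eq_iff]; constructor <;> linarith
  refine ⟨h, ?_⟩
  rw [Int.fract, h]; ring

lemma floor_fract_sub {i : ℤ} {α : ℝ} (h0 : 0 < α) (h1 : α ≤ 1) :
    ⌊(i : ℝ) - α⌋ = i - 1 ∧ Int.fract ((i : ℝ) - α) = 1 - α := by
  have h : ⌊(i : ℝ) - α⌋ = i - 1 := by
    rw [Int.floor_eq_iff]; push_cast; constructor <;> linarith
  refine ⟨h, ?_⟩
  rw [Int.fract, h]; push_cast; ring

lemma interp_up (i j : ℤ) {α β : ℝ} (hα : 0 ≤ α) (hβ : 0 ≤ β) (h : α + β ≤ 1) :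
    interp V (i + α, j + β) =
      (1 - α - β) • V (i, j) + α • V (i + 1, j) + β • V (i, j + 1) := by
  -- The floor jumps to the next cell at the corners α = 1 and β = 1, so these are treated apart.
  rcases eq_or_lt_of_le (show α ≤ 1 by linarith) with h1 | h1
  · obtain rfl : β = 0 := by linarith
    subst h1
    simp [interp]
  rcases eq_or_lt_of_le (show β ≤ 1 by linarith) with h2 | h2
  · obtain rfl : α = 0 := by linarith
    subst h2
    simp [interp]
  obtain ⟨a1, a2⟩ := floor_fract_add (i := i) hα h1
  obtain ⟨b1, b2⟩ := floor_fract_add (i := j) hβ h2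
  simp only [interp, a1, a2, b1, b2, if_pos h]

lemma interp_down (i j : ℤ) {α β : ℝ} (hα : 0 ≤ α) (hβ : 0 ≤ β) (h : α + β ≤ 1) :
    interp V (i - α, j - β) =
      (1 - α - β) • V (i, j) + α • V (i - 1, j) + β • V (i, j - 1) := by
  rcases eq_or_lt_of_le hα with rfl | h1
  · rcases eq_or_lt_of_le hβ with rfl | h2
    · simp [interp]
    · obtain ⟨b1, b2⟩ := floor_fract_sub (i := j) h2 (by linarith)
      have : (0 : ℝ) + (1 - β) ≤ 1 := by linarith
      simp only [interp, sub_zero, Int.floor_intCast, Int.fract_intCast, b1, b2, if_pos this]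
      rw [sub_add_cancel]
      module
  · rcases eq_or_lt_of_le hβ with rfl | h2
    · obtain ⟨b1, b2⟩ := floor_fract_sub (i := i) h1 (by linarith)
      have : (1 - α) + 0 ≤ 1 := by linarith
      simp only [interp, sub_zero, Int.floor_intCast, Int.fract_intCast, b1, b2, if_pos this]
      rw [sub_add_cancel]
      module
    · obtain ⟨a1, a2⟩ := floor_fract_sub (i := i) h1 (by linarith)
      obtain ⟨b1, b2⟩ := floor_fract_sub (i := j) h2 (by linarith)
      simp only [interp, a1, a2, b1, b2, sub_add_cancel]
      -- The first branch occurs only on the diagonal α + β = 1, where both formulas agree.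
      split_ifs with h3
      · obtain rfl : β = 1 - α := by linarith
        module
      · module

lemma sum_weights {w : Fin 3 → ℝ} (hw : w ∈ stdSimplex ℝ (Fin 3)) :
    0 ≤ w 0 ∧ 0 ≤ w 1 ∧ 0 ≤ w 2 ∧ w 0 = 1 - w 1 - w 2 := by
  have := hw.2
  rw [Fin.sum_univ_three] at this
  exact ⟨hw.1 0, hw.1 1, hw.1 2, by linarith⟩

lemma comb_latticeTriangle (v : ℤ × ℤ) (ε : ℤˣ) {w : Fin 3 → ℝ} (hw : w ∈ stdSimplex ℝ (Fin 3)) :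
    comb (toPlane ∘ latticeTriangle v ε) w =
      (v.1 + (ε : ℤ) * w 1, v.2 + (ε : ℤ) * w 2) := by
  obtain ⟨-, -, -, h⟩ := sum_weights hw
  simp only [comb, Fin.sum_univ_three, Function.comp, latticeTriangle, toPlane, h]
  ext <;> simp <;> ring

/-- The piecewise linear extension is affine on the triangles of the standard triangulation. -/
lemma interp_comb (v : ℤ × ℤ) (ε : ℤˣ) {w : Fin 3 → ℝ} (hw : w ∈ stdSimplex ℝ (Fin 3)) :
    interp V (comb (toPlane ∘ latticeTriangle v ε) w) = comb (V ∘ latticeTriangle v ε) w := by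
  rw [comb_latticeTriangle v ε hw]
  obtain ⟨h0, h1, h2, h⟩ := sum_weights hw
  rcases Int.units_eq_one_or ε with rfl | rfl
  · have := interp_up V v.1 v.2 h1 h2 (by linarith)
    simpa [comb, Fin.sum_univ_three, latticeTriangle, h] using this
  · have := interp_down V v.1 v.2 h1 h2 (by linarith)
    simpa [comb, Fin.sum_univ_three, latticeTriangle, h, ← sub_eq_add_neg] using this

/-- The triangles of the standard triangulation cover the plane. -/
lemma exists_comb_eq (p : ℝ × ℝ) : ∃ (v : ℤ × ℤ) (ε : ℤˣ), ∃ w ∈ stdSimplex ℝ (Fin 3),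
    comb (toPlane ∘ latticeTriangle v ε) w = p := by
  have f1 := Int.fract_nonneg p.1
  have f2 := Int.fract_nonneg p.2
  have g1 := Int.fract_lt_one p.1
  have g2 := Int.fract_lt_one p.2
  have e1 := Int.floor_add_fract p.1
  have e2 := Int.floor_add_fract p.2
  by_cases h : Int.fract p.1 + Int.fract p.2 ≤ 1
  · have hw : ![1 - Int.fract p.1 - Int.fract p.2, Int.fract p.1, Int.fract p.2] ∈
        stdSimplex ℝ (Fin 3) := by
      refine ⟨fun i => ?_, by simp [Fin.sum_univ_three]; ring⟩
      fin_cases i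
      all_goals simp <;> linarith
    refine ⟨(⌊p.1⌋, ⌊p.2⌋), 1, _, hw, ?_⟩
    rw [comb_latticeTriangle _ _ hw]
    ext <;> simp
  · have hw : ![Int.fract p.1 + Int.fract p.2 - 1, 1 - Int.fract p.1, 1 - Int.fract p.2] ∈
        stdSimplex ℝ (Fin 3) := by
      refine ⟨fun i => ?_, by simp [Fin.sum_univ_three]⟩
      fin_cases i <;> simp <;> linarith
    refine ⟨(⌊p.1⌋ + 1, ⌊p.2⌋ + 1), -1, _, hw, ?_⟩
    rw [comb_latticeTriangle _ _ hw]
    ext <;> simp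

lemma latticeTriangle_add (v u : ℤ × ℤ) (ε : ℤˣ) (i : Fin 3) :
    latticeTriangle (v + u) ε i = latticeTriangle v ε i + u := by
  fin_cases i <;> ext <;> simp [latticeTriangle] <;> ring

/-- Translations by lattice vectors permute the triangles and keep barycentric coordinates, whose
sum is 1. It serves with c = 0 for the surface and with c a lattice vector for the plane. -/
lemma interp_add_of_periodic {u : ℤ × ℤ} (c : E) (h : ∀ v, V (v + u) = V v + c) (p : ℝ × ℝ) :
    interp V (p + toPlane u) = interp V p + c := by
  obtain ⟨v, ε, w, hw, rfl⟩ := exists_comb_eq p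
  have : comb (toPlane ∘ latticeTriangle v ε) w + toPlane u =
      comb (toPlane ∘ latticeTriangle (v + u) ε) w := by
    rw [comb_latticeTriangle _ _ hw, comb_latticeTriangle _ _ hw]
    ext <;> simp [toPlane] <;> ring
  rw [this, interp_comb V _ _ hw, interp_comb V _ _ hw]
  simp only [comb, Function.comp, latticeTriangle_add, h, smul_add, Finset.sum_add_distrib,
    ← Finset.sum_smul, hw.2, one_smul]

/-- If a point of a triangle of the standard triangulation lies in a second triangle, then the
vertices of the first triangle which have positive weight are vertices of the second one. -/
lemma mem_range_latticeTriangle_of_pos {v v' : ℤ × ℤ} {ε ε' : ℤˣ} {w w' : Fin 3 → ℝ}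
    (hw : w ∈ stdSimplex ℝ (Fin 3)) (hw' : w' ∈ stdSimplex ℝ (Fin 3))
    (h : comb (toPlane ∘ latticeTriangle v ε) w = comb (toPlane ∘ latticeTriangle v' ε') w')
    {i : Fin 3} (hi : 0 < w i) :
    latticeTriangle v ε i ∈ Set.range (latticeTriangle v' ε') := by
  rw [comb_latticeTriangle _ _ hw, comb_latticeTriangle _ _ hw'] at h
  obtain ⟨h0, h1, h2, hs⟩ := sum_weights hw
  obtain ⟨h0', h1', h2', hs'⟩ := sum_weights hw'
  obtain ⟨v1, v2⟩ := v
  obtain ⟨v1', v2'⟩ := v'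
  simp only [Prod.mk.injEq] at h
  obtain ⟨e1, e2⟩ := h
  obtain ⟨⟨u1, u2⟩, hu⟩ : ∃ u, latticeTriangle (v1, v2) ε i = u := ⟨_, rfl⟩
  rw [hu]
  -- In coordinates adapted to the second triangle the point has x, y ≥ 0 and x + y ≤ 1. A vertex of
  -- positive weight differs from it by less than 1 in x, in y and in x + y. The strict inequalities
  -- leave only three integer positions.
  have key : (ε' : ℤ) * (u1 - v1') < 2 ∧ -1 < (ε' : ℤ) * (u1 - v1') ∧
      (ε' : ℤ) * (u2 - v2') < 2 ∧ -1 < (ε' : ℤ) * (u2 - v2') ∧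
      (ε' : ℤ) * (u1 - v1') + ε' * (u2 - v2') < 2 := by
    have : ((ε' : ℤ) : ℝ) * (u1 - v1') < 2 ∧ -1 < ((ε' : ℤ) : ℝ) * (u1 - v1') ∧
      ((ε' : ℤ) : ℝ) * (u2 - v2') < 2 ∧ -1 < ((ε' : ℤ) : ℝ) * (u2 - v2') ∧
      ((ε' : ℤ) : ℝ) * (u1 - v1') + (ε' : ℤ) * (u2 - v2') < 2 := by
      rcases Int.units_eq_one_or ε with rfl | rfl <;> rcases Int.units_eq_one_or ε' with rfl | rfl <;>
        fin_cases i <;> simp [latticeTriangle] at hu hi e1 e2 ⊢ <;> obtain ⟨rfl, rfl⟩ := hu <;>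
        push_cast <;> refine ⟨?_, ?_, ?_, ?_, ?_⟩ <;> linarith
    exact_mod_cast this
  rcases Int.units_eq_one_or ε' with rfl | rfl
  · have : (u1 = v1' ∧ u2 = v2') ∨ (u1 = v1' + 1 ∧ u2 = v2') ∨ (u1 = v1' ∧ u2 = v2' + 1) := by
      simp at key; omega
    rcases this with ⟨rfl, rfl⟩ | ⟨rfl, rfl⟩ | ⟨rfl, rfl⟩
    exacts [⟨0, by simp [latticeTriangle]⟩, ⟨1, by simp [latticeTriangle]⟩,
      ⟨2, by simp [latticeTriangle]⟩]
  · have : (u1 = v1' ∧ u2 = v2') ∨ (u1 = v1' + -1 ∧ u2 = v2') ∨ (u1 = v1' ∧ u2 = v2' + -1) := by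
      simp at key; omega
    rcases this with ⟨rfl, rfl⟩ | ⟨rfl, rfl⟩ | ⟨rfl, rfl⟩
    exacts [⟨0, by simp [latticeTriangle]⟩, ⟨1, by simp [latticeTriangle]⟩,
      ⟨2, by simp [latticeTriangle]⟩]

end Interp

/-! ### Barycentric coordinates and distances. -/

/-- The face of a triangle spanned by the vertices with index in `s` consists of the combinations
with weights that vanish outside `s`. -/
lemma convexHull_image_eq {E : Type*} [AddCommGroup E] [Module ℝ E] (v : Fin 3 → E)
    (s : Set (Fin 3)) :
    convexHull ℝ (v '' s) = comb v '' {w | w ∈ stdSimplex ℝ (Fin 3) ∧ ∀ i ∉ s, w i = 0} := by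
  apply subset_antisymm
  · refine convexHull_min ?_ ?_
    · rintro _ ⟨i, hi, rfl⟩
      refine ⟨Pi.single i 1, ⟨single_mem_stdSimplex ℝ i, fun j hj => ?_⟩, ?_⟩
      · exact Pi.single_eq_of_ne (by rintro rfl; exact hj hi) _
      · simp [comb, Pi.single_apply]
    · rintro _ ⟨w, ⟨hw, hs⟩, rfl⟩ _ ⟨w', ⟨hw', hs'⟩, rfl⟩ a b ha hb hab
      refine ⟨a • w + b • w', ⟨convex_stdSimplex ℝ _ hw hw' ha hb hab, fun i hi => ?_⟩, ?_⟩
      · simp [hs i hi, hs' i hi]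
      · simp only [comb, Pi.add_apply, Pi.smul_apply, smul_eq_mul, add_smul, mul_smul,
          Finset.sum_add_distrib, Finset.smul_sum]
  · rintro _ ⟨w, ⟨hw, hs⟩, rfl⟩
    classical
    have e : comb v w = ∑ i ∈ Finset.univ.filter (· ∈ s), w i • v i := by
      rw [comb, Finset.sum_filter]
      refine Finset.sum_congr rfl fun i _ => ?_
      split_ifs with h
      · rfl
      · rw [hs i h, zero_smul]
    have e' : ∑ i ∈ Finset.univ.filter (· ∈ s), w i = 1 := by
      rw [← hw.2, Finset.sum_filter]
      refine Finset.sum_congr rfl fun i _ => ?_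
      split_ifs with h
      · rfl
      · rw [hs i h]
    rw [e]
    refine (convex_convexHull ℝ _).sum_mem (fun i _ => hw.1 i) e' fun i hi => ?_
    exact subset_convexHull ℝ _ ⟨i, (Finset.mem_filter.1 hi).2, rfl⟩

lemma convexHull_range_eq {E : Type*} [AddCommGroup E] [Module ℝ E] (v : Fin 3 → E) :
    convexHull ℝ (Set.range v) = comb v '' stdSimplex ℝ (Fin 3) := by
  have := convexHull_image_eq v Set.univ
  simpa [Set.image_univ] using this

/-- A map that does not increase distances to nearby points by more than the factor `c` is
Lipschitz with constant `c`. -/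
lemma dist_le_of_eventually_dist_le {X E : Type*} [NormedAddCommGroup X] [NormedSpace ℝ X]
    [PseudoMetricSpace E] {F : X → E} {c : ℝ}
    (h : ∀ z, ∀ᶠ w in nhds z, dist (F z) (F w) ≤ c * dist z w) (z w : X) :
    dist (F z) (F w) ≤ c * dist z w := by
  have hF : Continuous F := by
    refine continuous_iff_continuousAt.2 fun x => ?_
    rw [ContinuousAt, tendsto_iff_dist_tendsto_zero]
    have h0 : Filter.Tendsto (fun y => c * dist x y) (nhds x) (nhds 0) := by
      have : Continuous fun y => c * dist x y := by fun_prop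
      simpa using this.tendsto x
    refine squeeze_zero' (.of_forall fun _ => dist_nonneg) ?_ h0
    filter_upwards [h x] with y hy
    rwa [dist_comm]
  let γ : ℝ → X := fun t => AffineMap.lineMap z w t
  have hγ : Continuous γ := AffineMap.lineMap_continuous
  have hd : ∀ s t, dist (γ s) (γ t) = |s - t| * dist z w := fun s t => by
    rw [dist_lineMap_lineMap, Real.dist_eq]
  -- Continuous induction along the segment: the set of times up to which the estimate holds is
  -- closed, and the local bound extends it to the right.
  let S : Set ℝ := {t | dist (F z) (F (γ t)) ≤ c * (t * dist z w)}
  have hS : IsClosed S := isClosed_le (by fun_prop) (by fun_prop)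
  have hsub : Set.Icc (0 : ℝ) 1 ⊆ S := by
    refine IsClosed.Icc_subset_of_forall_exists_gt (hS.inter isClosed_Icc) ?_ ?_
    · simp [S, γ]
    · rintro x ⟨hx, -⟩ y hy
      have h1 : ∀ᶠ t in nhdsWithin x (Set.Ioi x), dist (F (γ x)) (F (γ t)) ≤
          c * dist (γ x) (γ t) :=
        ((hγ.tendsto x).eventually (h (γ x))).filter_mono nhdsWithin_le_nhds
      have h2 : ∀ᶠ t in nhdsWithin x (Set.Ioi x), t ∈ Set.Ioc x y := Ioc_mem_nhdsGT hy
      obtain ⟨t, ht1, ht2⟩ := (h1.and h2).exists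
      refine ⟨t, ?_, ht2⟩
      have hx' : dist (F z) (F (γ x)) ≤ c * (x * dist z w) := hx
      rw [hd, abs_of_nonpos (by linarith [ht2.1])] at ht1
      change dist (F z) (F (γ t)) ≤ c * (t * dist z w)
      calc dist (F z) (F (γ t)) ≤ _ := dist_triangle _ (F (γ x)) _
        _ ≤ _ := add_le_add hx' ht1
        _ = _ := by ring
  simpa [S, γ] using hsub ⟨zero_le_one, le_rfl⟩

/-- Two triangles with proportional side lengths are similar: points with the same barycentric
coordinates have proportional distances. -/
lemma dist_comb_comb {E E' : Type*} [NormedAddCommGroup E] [InnerProductSpace ℝ E]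
    [NormedAddCommGroup E'] [InnerProductSpace ℝ E'] {a : Fin 3 → E} {b : Fin 3 → E'} {c : ℝ}
    (hc : 0 ≤ c) (h : ∀ i j, dist (a i) (a j) = c * dist (b i) (b j)) {w w' : Fin 3 → ℝ}
    (hw : w ∈ stdSimplex ℝ (Fin 3)) (hw' : w' ∈ stdSimplex ℝ (Fin 3)) :
    dist (comb a w) (comb a w') = c * dist (comb b w) (comb b w') := by
  have h0 : ∑ i, (w i - w' i) = 0 := by rw [Finset.sum_sub_distrib, hw.2, hw'.2, sub_self]
  have e1 : comb a w - comb a w' = ∑ i, (w i - w' i) • a i := by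
    simp [comb, sub_smul, Finset.sum_sub_distrib]
  have e2 : comb b w - comb b w' = ∑ i, (w i - w' i) • b i := by
    simp [comb, sub_smul, Finset.sum_sub_distrib]
  -- For weights of sum zero, the squared norm of a combination is a quadratic form in the mutual
  -- distances of the points alone.
  rw [← sq_eq_sq₀ dist_nonneg (by positivity), mul_pow, dist_eq_norm, dist_eq_norm, e1, e2,
    ← real_inner_self_eq_norm_sq, ← real_inner_self_eq_norm_sq,
    inner_sum_smul_sum_smul_of_sum_eq_zero _ h0 _ h0,
    inner_sum_smul_sum_smul_of_sum_eq_zero _ h0 _ h0]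
  simp only [← dist_eq_norm, h]
  rw [← mul_div_assoc, mul_neg, Finset.mul_sum]
  congr 2
  refine Finset.sum_congr rfl fun i _ => ?_
  rw [Finset.mul_sum]
  refine Finset.sum_congr rfl fun j _ => ?_
  ring

/-! ### The lattice and the flat torus. -/

lemma mem_lattice_iff {τ : ℍ} {z : ℂ} : z ∈ lattice τ ↔ ∃ m k : ℤ, z = k + m * (τ : ℂ) := by
  rw [lattice, AddSubgroup.mem_closure_pair]
  constructor
  · rintro ⟨k, m, rfl⟩; exact ⟨m, k, by simp⟩
  · rintro ⟨m, k, rfl⟩; exact ⟨k, m, by simp⟩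

lemma proj_eq_proj_iff {τ : ℍ} {z w : ℂ} : proj τ z = proj τ w ↔ w - z ∈ lattice τ := by
  rw [proj, proj, QuotientAddGroup.eq, neg_add_eq_sub]

lemma continuous_proj (τ : ℍ) : Continuous (proj τ) := continuous_quot_mk

/-- The torus is the image of a closed fundamental parallelogram. Compactness later turns a
continuous injection into an embedding. -/
instance compactSpace_flatTorus (τ : ℍ) : CompactSpace (FlatTorus τ) := by
  let g : ℝ × ℝ → FlatTorus τ := fun p => proj τ (p.1 + p.2 * (τ : ℂ))
  have hg : Continuous g := (continuous_proj τ).comp (by fun_prop)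
  have hK : IsCompact (g '' (Set.Icc 0 1 ×ˢ Set.Icc 0 1)) :=
    (isCompact_Icc.prod isCompact_Icc).image hg
  refine ⟨?_⟩
  convert hK
  refine (Set.eq_univ_of_forall fun q => ?_).symm
  obtain ⟨z, rfl⟩ := QuotientAddGroup.mk_surjective q
  have hτ := τ.im_pos
  set y : ℝ := z.im / τ.im
  set x : ℝ := z.re - y * τ.re
  refine ⟨(Int.fract x, Int.fract y), ⟨⟨Int.fract_nonneg _, (Int.fract_lt_one _).le⟩,
    ⟨Int.fract_nonneg _, (Int.fract_lt_one _).le⟩⟩, ?_⟩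
  refine proj_eq_proj_iff.2 (mem_lattice_iff.2 ⟨⌊y⌋, ⌊x⌋, ?_⟩)
  have hz : z = x + y * (τ : ℂ) := by
    apply Complex.ext
    · simp [x]
    · simp [y, hτ.ne']
  have ex : (x : ℂ) = ⌊x⌋ + (Int.fract x : ℝ) := by
    exact_mod_cast (Int.floor_add_fract x).symm
  have ey : (y : ℂ) = ⌊y⌋ + (Int.fract y : ℝ) := by
    exact_mod_cast (Int.floor_add_fract y).symm
  rw [hz]
  linear_combination ex + (τ : ℂ) * ey

/-! ### From a periodic surface to a realization of the torus. -/

section Realization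

variable {τ : ℍ} {V : ℤ × ℤ → E3} {W : ℤ × ℤ → ℂ} {c : ℝ}

/-- The piecewise linear map from the plane to space which maps `W v` to `V v` for `v ∈ ℤ × ℤ`. -/
def developedMap (hW : Function.Bijective (interp W)) (V : ℤ × ℤ → E3) (z : ℂ) : E3 :=
  interp V ((Equiv.ofBijective _ hW).symm z)

variable (hW : Function.Bijective (interp W))

lemma developedMap_interp (p : ℝ × ℝ) : developedMap hW V (interp W p) = interp V p := by
  rw [developedMap, Equiv.ofBijective_symm_apply_apply]

lemma developedMap_comb (v : ℤ × ℤ) (ε : ℤˣ) {w : Fin 3 → ℝ} (hw : w ∈ stdSimplex ℝ (Fin 3)) :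
    developedMap hW V (comb (W ∘ latticeTriangle v ε) w) = comb (V ∘ latticeTriangle v ε) w := by
  rw [← interp_comb W v ε hw, developedMap_interp, interp_comb V v ε hw]

lemma exists_comb_eq_of_bijective (hW : Function.Bijective (interp W)) (z : ℂ) : ∃ (v : ℤ × ℤ) (ε : ℤˣ), ∃ w ∈ stdSimplex ℝ (Fin 3),
    comb (W ∘ latticeTriangle v ε) w = z := by
  obtain ⟨p, rfl⟩ := hW.2 z
  obtain ⟨v, ε, w, hw, rfl⟩ := exists_comb_eq p
  exact ⟨v, ε, w, hw, (interp_comb W v ε hw).symm⟩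

lemma isClosed_convexHull_range {E : Type*} [NormedAddCommGroup E] [NormedSpace ℝ E]
    (v : Fin 3 → E) : IsClosed (convexHull ℝ (Set.range v)) :=
  (Set.finite_range v).isClosed_convexHull ℝ

/-- The triangles of a developed triangulation form a locally finite family. -/
lemma locallyFinite_convexHull (hfin : ∀ R : ℝ, {v | ‖W v‖ ≤ R}.Finite) {D : ℝ}
    (hD : ∀ v ε i, ‖W (latticeTriangle v ε i) - W v‖ ≤ D) :
    LocallyFinite fun x : (ℤ × ℤ) × ℤˣ =>
      convexHull ℝ (Set.range (W ∘ latticeTriangle x.1 x.2)) := by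
  intro z
  refine ⟨Metric.ball z 1, Metric.ball_mem_nhds z one_pos, ?_⟩
  refine ((hfin (‖z‖ + 1 + D)).prod (Set.finite_univ (α := ℤˣ))).subset ?_
  rintro ⟨v, ε⟩ ⟨y, hy, hyz⟩
  refine ⟨?_, trivial⟩
  have h1 : convexHull ℝ (Set.range (W ∘ latticeTriangle v ε)) ⊆ Metric.closedBall (W v) D := by
    refine convexHull_min ?_ (convex_closedBall _ _)
    rintro _ ⟨i, rfl⟩
    simpa [dist_eq_norm] using hD v ε i
  have h2 := h1 hy
  rw [Metric.mem_closedBall, dist_eq_norm, norm_sub_rev] at h2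
  rw [Metric.mem_ball, dist_eq_norm] at hyz
  change ‖W v‖ ≤ _
  calc ‖W v‖ = ‖(W v - y) + (y - z) + z‖ := by congr 1; ring
    _ ≤ ‖W v - y‖ + ‖y - z‖ + ‖z‖ := norm_add₃_le
    _ ≤ _ := by linarith

lemma dist_developedMap_of_mem (hc : 0 ≤ c)
    (hdist : ∀ v ε i j, dist (V (latticeTriangle v ε i)) (V (latticeTriangle v ε j)) =
      c * dist (W (latticeTriangle v ε i)) (W (latticeTriangle v ε j)))
    {v : ℤ × ℤ} {ε : ℤˣ} {z z' : ℂ}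
    (hz : z ∈ convexHull ℝ (Set.range (W ∘ latticeTriangle v ε)))
    (hz' : z' ∈ convexHull ℝ (Set.range (W ∘ latticeTriangle v ε))) :
    dist (developedMap hW V z) (developedMap hW V z') = c * dist z z' := by
  rw [convexHull_range_eq] at hz hz'
  obtain ⟨w, hw, rfl⟩ := hz
  obtain ⟨w', hw', rfl⟩ := hz'
  rw [developedMap_comb hW v ε hw, developedMap_comb hW v ε hw']
  exact dist_comb_comb hc (fun i j => hdist v ε i j) hw hw'

/-- Near a point z only triangles containing z occur, by local finiteness, so the map is a
similarity between z and any nearby point. The global Lipschitz bound follows along segments. -/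
lemma dist_developedMap_le (hc : 0 ≤ c) (hfin : ∀ R : ℝ, {v | ‖W v‖ ≤ R}.Finite) {D : ℝ}
    (hD : ∀ v ε i, ‖W (latticeTriangle v ε i) - W v‖ ≤ D)
    (hdist : ∀ v ε i j, dist (V (latticeTriangle v ε i)) (V (latticeTriangle v ε j)) =
      c * dist (W (latticeTriangle v ε i)) (W (latticeTriangle v ε j))) (z z' : ℂ) :
    dist (developedMap hW V z) (developedMap hW V z') ≤ c * dist z z' := by
  refine dist_le_of_eventually_dist_le (fun x => ?_) z z'
  filter_upwards [(locallyFinite_convexHull hfin hD).eventually_subset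
    (fun _ => isClosed_convexHull_range _) x] with y hy
  obtain ⟨v, ε, w, hw, hwy⟩ := exists_comb_eq_of_bijective hW y
  have hmem : y ∈ convexHull ℝ (Set.range (W ∘ latticeTriangle v ε)) := by
    rw [convexHull_range_eq]; exact ⟨w, hw, hwy⟩
  exact (dist_developedMap_of_mem hW hc hdist (@hy (v, ε) hmem) hmem).le

end Realization

section Realization

variable {τ : ℍ} {V : ℤ × ℤ → E3} {W : ℤ × ℤ → ℂ} {c : ℝ} {Γ : AddSubgroup (ℤ × ℤ)}

/-- The fibres of the developed map and those of the projection to the torus are both the orbits of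
Γ, which acts trivially on the surface and by the lattice on the plane. -/
lemma developedMap_eq_iff (hW : Function.Bijective (interp W))
    (hV : ∀ γ ∈ Γ, ∀ v, V (v + γ) = V v)
    (hinj : ∀ p q, interp V p = interp V q → ∃ γ ∈ Γ, q = p + toPlane γ)
    (hΓ : ∀ γ ∈ Γ, ∃ l ∈ lattice τ, ∀ v, W (v + γ) = W v + l)
    (hτ : ∀ l ∈ lattice τ, ∃ γ ∈ Γ, ∀ v, W (v + γ) = W v + l) (z z' : ℂ) :
    developedMap hW V z = developedMap hW V z' ↔ proj τ z = proj τ z' := by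
  obtain ⟨p, rfl⟩ := hW.2 z
  obtain ⟨q, rfl⟩ := hW.2 z'
  rw [developedMap_interp, developedMap_interp, proj_eq_proj_iff]
  constructor
  · intro h
    obtain ⟨γ, hγ, rfl⟩ := hinj p q h
    obtain ⟨l, hl, hl'⟩ := hΓ γ hγ
    rw [interp_add_of_periodic W l hl']
    simpa using hl
  · intro h
    obtain ⟨γ, hγ, hl⟩ := hτ _ h
    have : q = p + toPlane γ := by
      apply hW.1
      rw [interp_add_of_periodic W _ hl]
      ring
    rw [this, interp_add_of_periodic V 0 (fun v => by rw [hV γ hγ v, add_zero]), add_zero]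

/-- Two triangles of a periodic triangulated surface without self-intersections meet in the common
face spanned by their common vertices. -/
lemma convexHull_inter_convexHull (hV : ∀ γ ∈ Γ, ∀ v, V (v + γ) = V v)
    (hinj : ∀ p q, interp V p = interp V q → ∃ γ ∈ Γ, q = p + toPlane γ)
    (v v' : ℤ × ℤ) (ε ε' : ℤˣ) :
    convexHull ℝ (Set.range (V ∘ latticeTriangle v ε)) ∩
      convexHull ℝ (Set.range (V ∘ latticeTriangle v' ε')) =
    convexHull ℝ ((V ∘ latticeTriangle v ε) ''
      {i | V (latticeTriangle v ε i) ∈ Set.range (V ∘ latticeTriangle v' ε')}) := by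
  apply subset_antisymm
  · rintro x ⟨hx, hx'⟩
    rw [convexHull_range_eq] at hx hx'
    obtain ⟨w, hw, rfl⟩ := hx
    obtain ⟨w', hw', h⟩ := hx'
    rw [← interp_comb V v ε hw, ← interp_comb V v' ε' hw'] at h
    obtain ⟨γ, hγ, h⟩ := hinj _ _ h
    rw [convexHull_image_eq]
    refine ⟨w, ⟨hw, fun i hi => ?_⟩, rfl⟩
    by_contra hwi
    have hpos : 0 < w i := lt_of_le_of_ne (hw.1 i) (Ne.symm hwi)
    have e : comb (toPlane ∘ latticeTriangle v ε) w =
        comb (toPlane ∘ latticeTriangle (v' + γ) ε') w' := by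
      rw [h, comb_latticeTriangle _ _ hw', comb_latticeTriangle _ _ hw']
      ext <;> simp [toPlane] <;> ring
    obtain ⟨j, hj⟩ := mem_range_latticeTriangle_of_pos hw hw' e hpos
    refine hi ⟨j, ?_⟩
    rw [← hj, latticeTriangle_add, hV γ hγ]
    rfl
  · refine Set.subset_inter (convexHull_mono (Set.image_subset_range _ _)) (convexHull_mono ?_)
    rintro _ ⟨i, hi, rfl⟩
    exact hi

/-- A periodic piecewise linear surface without self-intersections whose triangles are similar to
those of a periodic triangulation of the plane realizes the corresponding flat torus. -/
theorem isRealizedBy_of_periodic (hc : 0 < c) (hW : Function.Bijective (interp W))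
    (hfin : ∀ R : ℝ, {v | ‖W v‖ ≤ R}.Finite) {D : ℝ}
    (hD : ∀ v ε i, ‖W (latticeTriangle v ε i) - W v‖ ≤ D)
    (hindep : ∀ v ε, AffineIndependent ℝ (W ∘ latticeTriangle v ε))
    (hdist : ∀ v ε i j, dist (V (latticeTriangle v ε i)) (V (latticeTriangle v ε j)) =
      c * dist (W (latticeTriangle v ε i)) (W (latticeTriangle v ε j)))
    (hV : ∀ γ ∈ Γ, ∀ v, V (v + γ) = V v)
    (hinj : ∀ p q, interp V p = interp V q → ∃ γ ∈ Γ, q = p + toPlane γ)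
    (hΓ : ∀ γ ∈ Γ, ∃ l ∈ lattice τ, ∀ v, W (v + γ) = W v + l)
    (hτ : ∀ l ∈ lattice τ, ∃ γ ∈ Γ, ∀ v, W (v + γ) = W v + l)
    {𝒯 : Set (Set E3)} (h𝒯 : ∀ t, t ∈ 𝒯 ↔ ∃ v ε, t = Set.range (V ∘ latticeTriangle v ε))
    (hfin𝒯 : 𝒯.Finite) : IsRealizedBy τ 𝒯 := by
  set F : ℂ → E3 := developedMap hW V with hF
  have hiff : ∀ z z', F z = F z' ↔ proj τ z = proj τ z' :=
    developedMap_eq_iff hW hV hinj hΓ hτ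
  -- The chosen lift is irrelevant, since F is constant on the fibres of the projection.
  let f : FlatTorus τ → E3 := fun q => F q.out
  have hf : ∀ z, f (proj τ z) = F z := fun z =>
    (hiff _ _).2 (Quotient.out_eq' (proj τ z))
  have hmk : ∀ q : FlatTorus τ, ∃ z, proj τ z = q := QuotientAddGroup.mk_surjective
  have hfinj : Function.Injective f := by
    intro q q' h
    obtain ⟨z, rfl⟩ := hmk q
    obtain ⟨z', rfl⟩ := hmk q'
    rw [hf, hf] at h
    exact (hiff z z').1 h
  have hlip : ∀ z z', dist (F z) (F z') ≤ c * dist z z' :=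
    dist_developedMap_le hW hc.le hfin hD hdist
  have hFcont : Continuous F :=
    (LipschitzWith.of_dist_le_mul (K := ⟨c, hc.le⟩) hlip).continuous
  have hfcont : Continuous f := by
    have : Topology.IsQuotientMap (proj τ) := isQuotientMap_quot_mk
    rw [this.continuous_iff]
    convert hFcont using 1
    funext z
    exact hf z
  have hcomb : ∀ v ε, ∀ s : Set (Fin 3),
      f '' (proj τ '' convexHull ℝ ((W ∘ latticeTriangle v ε) '' s)) =
        convexHull ℝ ((V ∘ latticeTriangle v ε) '' s) := by
    intro v ε s
    rw [convexHull_image_eq, convexHull_image_eq, Set.image_image, Set.image_image]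
    refine Set.image_congr fun w hw => ?_
    rw [hf, hF, developedMap_comb hW v ε hw.1]
  have hiso : ∀ v ε z z', z ∈ convexHull ℝ (Set.range (W ∘ latticeTriangle v ε)) →
      z' ∈ convexHull ℝ (Set.range (W ∘ latticeTriangle v ε)) →
      dist (F z) (F z') = c * dist z z' := fun v ε z z' hz hz' =>
    dist_developedMap_of_mem hW hc.le hdist hz hz'
  choose v ε hvε using fun t : 𝒯 => (h𝒯 t).1 t.2
  let T : 𝒯 → FlatTriangle τ := fun t =>
    { vertex := W ∘ latticeTriangle (v t) (ε t)
      indep := hindep _ _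
      inj := by
        intro z hz z' hz' h
        have h1 := hiso _ _ z z' hz hz'
        rw [(hiff z z').2 h, dist_self] at h1
        rcases mul_eq_zero.1 h1.symm with h2 | h2
        · exact absurd h2 hc.ne'
        · exact dist_eq_zero.1 h2 }
  have hface : ∀ (t : 𝒯) (s : Set (Fin 3)),
      f '' (T t).face s = convexHull ℝ ((V ∘ latticeTriangle (v t) (ε t)) '' s) :=
    fun t s => hcomb _ _ s
  have hcarrier : ∀ t : 𝒯, f '' (T t).carrier = convexHull ℝ (t : Set E3) := by
    intro t
    rw [FlatTriangle.carrier, hface, Set.image_univ, ← hvε]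
  have hVinj : ∀ v ε, Function.Injective (V ∘ latticeTriangle v ε) := by
    intro v ε i j h
    have h1 := hdist v ε i j
    simp only [Function.comp] at h
    rw [h, dist_self] at h1
    rcases mul_eq_zero.1 h1.symm with h2 | h2
    · exact absurd h2 hc.ne'
    · exact (hindep v ε).injective (dist_eq_zero.1 h2)
  -- With exactly three vertices each, distinct members of 𝒯 cannot contain one another, so the
  -- common face is proper.
  have hcard : ∀ t : 𝒯, (t : Set E3).ncard = 3 := by
    intro t
    rw [hvε t, ← Set.image_univ, Set.ncard_image_of_injective _ (hVinj _ _), Set.ncard_univ]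
    simp
  have hsub : ∀ t t' : 𝒯, t ≠ t' →
      {i | V (latticeTriangle (v t) (ε t) i) ∈ (t' : Set E3)} ≠ Set.univ := by
    intro t t' hne h
    apply hne
    apply Subtype.ext
    have hfin' : (t' : Set E3).Finite := by rw [hvε t']; exact Set.finite_range _
    refine Set.eq_of_subset_of_ncard_le ?_ (by rw [hcard, hcard]) hfin'
    rw [hvε t]
    rintro _ ⟨i, rfl⟩
    exact Set.eq_univ_iff_forall.1 h i
  have hint : ∀ t t' : 𝒯, (T t).carrier ∩ (T t').carrier =
      (T t).face {i | V (latticeTriangle (v t) (ε t) i) ∈ (t' : Set E3)} := by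
    intro t t'
    apply hfinj.image_injective
    rw [Set.image_inter hfinj, hcarrier, hcarrier, hface]
    have := convexHull_inter_convexHull hV hinj (v t) (v t') (ε t) (ε t')
    rwa [← hvε t, ← hvε t'] at this
  have hrange : Set.range f = polyhedron 𝒯 := by
    apply subset_antisymm
    · rintro _ ⟨q, rfl⟩
      obtain ⟨z, rfl⟩ := hmk q
      obtain ⟨u, e, w, hw, rfl⟩ := exists_comb_eq_of_bijective hW z
      rw [hf, hF, developedMap_comb hW _ _ hw]
      refine Set.mem_biUnion ((h𝒯 _).2 ⟨u, e, rfl⟩) ?_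
      rw [convexHull_range_eq]
      exact ⟨w, hw, rfl⟩
    · refine Set.iUnion₂_subset fun t ht => ?_
      rw [← hcarrier ⟨t, ht⟩]
      exact Set.image_subset_range _ _
  -- A continuous injection of the compact torus into a Hausdorff space is an embedding.
  refine ⟨c, f, T, hc, (hfcont.isClosedEmbedding hfinj).isEmbedding, hrange,
    ⟨hfin𝒯.to_subtype, ?_, ?_⟩, ?_, fun t => ⟨?_, hcarrier t⟩⟩
  · refine Set.eq_univ_of_forall fun q => ?_
    have : f q ∈ polyhedron 𝒯 := hrange ▸ Set.mem_range_self q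
    obtain ⟨t, ht, hq⟩ := Set.mem_iUnion₂.1 this
    rw [← hcarrier ⟨t, ht⟩] at hq
    obtain ⟨q', hq', h⟩ := hq
    exact Set.mem_iUnion.2 ⟨⟨t, ht⟩, hfinj h ▸ hq'⟩
  · intro t t' hne
    refine ⟨_, _, hsub t t' hne, hsub t' t hne.symm, hint t t', ?_⟩
    rw [Set.inter_comm]
    exact hint t' t
  · rintro t _ ⟨z, hz, rfl⟩ _ ⟨z', hz', rfl⟩
    rw [Set.image_univ] at hz hz'
    rw [hf, hf]
    -- The quotient distance could be shorter than the distance inside the triangle. It is not: for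
    -- every lift m of the difference, F z = F (m + z') lies within c‖m‖ of F z' by the global
    -- Lipschitz bound.
    have h1 : dist (proj τ z) (proj τ z') = ‖proj τ (z - z')‖ := dist_eq_norm _ _
    refine le_antisymm ?_ ?_
    · rw [h1, mul_comm, ← div_le_iff₀ hc, proj, QuotientAddGroup.le_norm_iff]
      intro m hm
      have h2 : F z = F (m + z') := by
        rw [hiff, proj_eq_proj_iff]
        have := (proj_eq_proj_iff (τ := τ)).1 hm
        rw [← neg_mem_iff]
        convert this using 1
        ring
      rw [h2, div_le_iff₀ hc, mul_comm]
      simpa using hlip (m + z') z'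
    · rw [hiso _ _ z z' hz hz', h1]
      refine mul_le_mul_of_nonneg_left ?_ hc.le
      rw [dist_eq_norm]
      exact QuotientAddGroup.norm_mk_le_norm
  · rw [hvε t, FlatTriangle.vertexSet, ← Set.range_comp]
    congr 1
    funext i
    simp only [Function.comp]
    rw [hf, hF]
    have h1 : (Pi.single i 1 : Fin 3 → ℝ) ∈ stdSimplex ℝ (Fin 3) := single_mem_stdSimplex ℝ i
    have h2 := developedMap_comb (V := V) hW (v t) (ε t) h1
    change developedMap hW V (W (latticeTriangle (v t) (ε t) i)) = _
    simpa [comb, Pi.single_apply] using h2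

end Realization

/-! ### Chords of the regular polygon. -/

/-- The point `e^{iπθ/n}` of the unit circle. -/
def dir (n : ℤ) (θ : ℝ) : ℂ := Complex.exp ((Real.pi * θ / n : ℝ) * Complex.I)

/-- The parametrization of the regular `n`-gon by `ℝ / nℤ` with vertex `e^{2πik/n}` at `k`, affine
on the sides. -/
def polygon (n : ℤ) (X : ℝ) : ℂ :=
  (1 - Int.fract X : ℝ) * dir n (2 * ⌊X⌋) + (Int.fract X : ℝ) * dir n (2 * ⌊X⌋ + 2)

section Chords

variable {n : ℤ}

lemma dir_add (θ θ' : ℝ) : dir n (θ + θ') = dir n θ * dir n θ' := by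
  rw [dir, dir, dir, ← Complex.exp_add]
  congr 1
  push_cast
  ring

lemma dir_eq (θ : ℝ) :
    dir n θ = (Real.cos (Real.pi * θ / n) : ℝ) + (Real.sin (Real.pi * θ / n) : ℝ) * Complex.I := by
  rw [dir, Complex.exp_mul_I, ← Complex.ofReal_cos, ← Complex.ofReal_sin]

lemma norm_dir (θ : ℝ) : ‖dir n θ‖ = 1 := Complex.norm_exp_ofReal_mul_I _

lemma dir_ne_zero (θ : ℝ) : dir n θ ≠ 0 := Complex.exp_ne_zero _

lemma dir_add_two_mul (hn : 4 < n) (θ : ℝ) (q : ℤ) : dir n (θ + 2 * (q * n)) = dir n θ := by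
  have hn' : (n : ℝ) ≠ 0 := by exact_mod_cast (show n ≠ 0 by omega)
  rw [dir, dir, Complex.exp_eq_exp_iff_exists_int]
  refine ⟨q, ?_⟩
  have : Real.pi * (θ + 2 * (q * n)) / n = Real.pi * θ / n + q * (2 * Real.pi) := by
    field_simp
  rw [this]
  push_cast
  ring

lemma eq_add_of_mul_dir_eq (hn : 4 < n) {r r' θ θ' : ℝ} (hr : 0 < r) (hr' : 0 < r')
    (h : r * dir n θ = r' * dir n θ') : ∃ q : ℤ, θ = θ' + 2 * (q * n) := by
  have hn' : (n : ℝ) ≠ 0 := by exact_mod_cast (show n ≠ 0 by omega)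
  have h1 : r = r' := by
    have := congrArg norm h
    simpa [norm_dir, abs_of_pos hr, abs_of_pos hr'] using this
  subst h1
  have h2 := mul_left_cancel₀ (by exact_mod_cast hr.ne') h
  rw [dir, dir, Complex.exp_eq_exp_iff_exists_int] at h2
  obtain ⟨q, hq⟩ := h2
  refine ⟨q, ?_⟩
  have h3 : (((Real.pi * θ / n : ℝ) : ℂ) - ((Real.pi * θ' / n + q * (2 * Real.pi) : ℝ) : ℂ)) *
      Complex.I = 0 := by
    push_cast at hq ⊢
    linear_combination hq
  rcases mul_eq_zero.1 h3 with h4 | h4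
  · have h5 : Real.pi * θ / n = Real.pi * θ' / n + q * (2 * Real.pi) := by
      have := sub_eq_zero.1 h4
      exact_mod_cast this
    field_simp at h5
    linarith
  · exact absurd h4 Complex.I_ne_zero

/-- A combination with nonnegative weights of directions in a narrow sector lies in that sector. -/
lemma exists_sum_dir_eq {ι : Type*} (s : Finset ι) (r θ : ι → ℝ) {L U : ℝ} (hn : 4 < n)
    (hLU : U - L ≤ 2) (hr : ∀ i ∈ s, 0 ≤ r i) (hθ : ∀ i ∈ s, r i ≠ 0 → L ≤ θ i ∧ θ i ≤ U)
    (hpos : ∃ i ∈ s, 0 < r i) :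
    ∃ ρ ϑ : ℝ, 0 < ρ ∧ L ≤ ϑ ∧ ϑ ≤ U ∧ ∑ i ∈ s, r i * dir n (θ i) = ρ * dir n ϑ := by
  have hn' : (5 : ℝ) ≤ n := by exact_mod_cast hn
  have hsmall : ∀ x : ℝ, x ≤ 2 → Real.pi * x / n < Real.pi / 2 := fun x hx => by
    rw [div_lt_div_iff₀ (by linarith) two_pos]
    nlinarith [Real.pi_pos]
  -- φ t is the component of the sum orthogonal to the direction t. It changes sign across the
  -- sector, and at a zero the sum points along t; the cosines are positive because the sector has
  -- angle at most 2π/n < π/2.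
  let φ : ℝ → ℝ := fun t => ∑ i ∈ s, r i * Real.sin (Real.pi * (θ i - t) / n)
  have hφ : Continuous φ := by fun_prop
  obtain ⟨i₀, hi₀, hri₀⟩ := hpos
  obtain ⟨hL₀, hU₀⟩ := hθ i₀ hi₀ hri₀.ne'
  have hL : 0 ≤ φ L := by
    refine Finset.sum_nonneg fun i hi => ?_
    by_cases h0 : r i = 0
    · simp [h0]
    obtain ⟨h1, h2⟩ := hθ i hi h0
    refine mul_nonneg (hr i hi) (Real.sin_nonneg_of_nonneg_of_le_pi ?_ ?_)
    · have : 0 ≤ θ i - L := by linarith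
      have := Real.pi_pos
      positivity
    · linarith [hsmall (θ i - L) (by linarith), Real.pi_pos]
  have hU : φ U ≤ 0 := by
    refine Finset.sum_nonpos fun i hi => ?_
    by_cases h0 : r i = 0
    · simp [h0]
    obtain ⟨h1, h2⟩ := hθ i hi h0
    refine mul_nonpos_of_nonneg_of_nonpos (hr i hi) ?_
    rw [show Real.pi * (θ i - U) / n = -(Real.pi * (U - θ i) / n) by ring, Real.sin_neg,
      neg_nonpos]
    refine Real.sin_nonneg_of_nonneg_of_le_pi ?_ ?_
    · have : 0 ≤ U - θ i := by linarith
      have := Real.pi_pos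
      positivity
    · linarith [hsmall (U - θ i) (by linarith), Real.pi_pos]
  obtain ⟨t, ⟨ht1, ht2⟩, ht⟩ := intermediate_value_Icc' (hL₀.trans hU₀) hφ.continuousOn ⟨hU, hL⟩
  have hcos : ∀ i ∈ s, r i ≠ 0 → 0 < Real.cos (Real.pi * (θ i - t) / n) := by
    intro i hi h0
    obtain ⟨h1, h2⟩ := hθ i hi h0
    refine Real.cos_pos_of_mem_Ioo ⟨?_, hsmall _ (by linarith)⟩
    have := hsmall (t - θ i) (by linarith)
    rw [show Real.pi * (t - θ i) / n = -(Real.pi * (θ i - t) / n) by ring] at this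
    linarith
  refine ⟨∑ i ∈ s, r i * Real.cos (Real.pi * (θ i - t) / n), t, ?_, ht1, ht2, ?_⟩
  · refine Finset.sum_pos' (fun i hi => ?_) ⟨i₀, hi₀, mul_pos hri₀ (hcos i₀ hi₀ hri₀.ne')⟩
    by_cases h0 : r i = 0
    · simp [h0]
    · exact mul_nonneg (hr i hi) (hcos i hi h0).le
  · have h1 : ∀ i ∈ s, (r i : ℂ) * dir n (θ i) =
        (((r i * Real.cos (Real.pi * (θ i - t) / n) : ℝ) : ℂ) +
          ((r i * Real.sin (Real.pi * (θ i - t) / n) : ℝ) : ℂ) * Complex.I) * dir n t := by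
      intro i _
      rw [show θ i = (θ i - t) + t by ring, dir_add, dir_eq (θ i - t)]
      simp only [add_sub_cancel_right]
      push_cast
      ring
    rw [Finset.sum_congr rfl h1, ← Finset.sum_mul, Finset.sum_add_distrib, ← Finset.sum_mul,
      ← Complex.ofReal_sum, ← Complex.ofReal_sum]
    have h2 : ∑ i ∈ s, r i * Real.sin (Real.pi * (θ i - t) / n) = 0 := ht
    rw [h2]
    simp

lemma dir_sub_dir (i j : ℝ) : dir n (2 * j) - dir n (2 * i) =
    (2 * Real.sin (Real.pi * (j - i) / n) : ℝ) * (Complex.I * dir n (i + j)) := by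
  rw [show 2 * j = (i + j) + (j - i) by ring, show 2 * i = (i + j) + (i - j) by ring,
    dir_add (i + j) (j - i), dir_add (i + j) (i - j), dir_eq (j - i), dir_eq (i - j),
    show Real.pi * (i - j) / n = -(Real.pi * (j - i) / n) by ring, Real.cos_neg, Real.sin_neg]
  push_cast
  ring

lemma polygon_eq {X : ℝ} {k : ℤ} (h1 : (k : ℝ) ≤ X) (h2 : X ≤ k + 1) :
    polygon n X = (1 - (X - k) : ℝ) * dir n (2 * k) + (X - k : ℝ) * dir n (2 * k + 2) := by
  rcases eq_or_lt_of_le h2 with h | h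
  · have e : X = ((k + 1 : ℤ) : ℝ) := by rw [h]; push_cast; ring
    rw [polygon, e, Int.floor_intCast, Int.fract_intCast]
    push_cast
    rw [show (2 : ℝ) * (k + 1) = 2 * k + 2 by ring]
    ring
  · have e : ⌊X⌋ = k := by rw [Int.floor_eq_iff]; exact ⟨h1, h⟩
    rw [polygon, Int.fract, e]

lemma polygon_add_mul (hn : 4 < n) (X : ℝ) (q : ℤ) : polygon n (X + q * n) = polygon n X := by
  have e : X + q * n = X + ((q * n : ℤ) : ℝ) := by push_cast; ring
  rw [polygon, polygon, e, Int.floor_add_intCast, Int.fract_add_intCast]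
  push_cast
  rw [show (2 : ℝ) * (⌊X⌋ + q * n) + 2 = (2 * ⌊X⌋ + 2) + 2 * (q * n) by ring,
    show (2 : ℝ) * (⌊X⌋ + q * n) = 2 * ⌊X⌋ + 2 * (q * n) by ring,
    dir_add_two_mul hn, dir_add_two_mul hn]

lemma sin_pi_mul_nonneg (hn : 4 < n) {x : ℝ} (h0 : 0 ≤ x) (h1 : x ≤ n) :
    0 ≤ Real.sin (Real.pi * x / n) := by
  have hn' : (5 : ℝ) ≤ n := by exact_mod_cast hn
  have := Real.pi_pos
  refine Real.sin_nonneg_of_nonneg_of_le_pi (by positivity) ?_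
  rw [div_le_iff₀ (by linarith)]
  exact mul_le_mul_of_nonneg_left h1 this.le

lemma sin_pi_mul_pos (hn : 4 < n) {x : ℝ} (h0 : 0 < x) (h1 : x < n) :
    0 < Real.sin (Real.pi * x / n) := by
  have hn' : (5 : ℝ) ≤ n := by exact_mod_cast hn
  have := Real.pi_pos
  refine Real.sin_pos_of_pos_of_lt_pi (by positivity) ?_
  rw [div_lt_iff₀ (by linarith)]
  exact mul_lt_mul_of_pos_left h1 this

/-- The direction of a chord of the regular `n`-gon, up to a quarter turn, in terms of its
endpoints. -/
lemma exists_polygon_sub_eq (hn : 4 < n) {u v : ℝ} (huv : u < v) (hvu : v < u + n) :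
    ∃ r θ : ℝ, 0 < r ∧ (⌊u⌋ : ℝ) + ⌊v⌋ ≤ θ ∧ θ ≤ ⌈u⌉ + ⌈v⌉ ∧
      polygon n v - polygon n u = r * (Complex.I * dir n θ) := by
  have hn0 : (n : ℝ) ≠ 0 := by exact_mod_cast (show n ≠ 0 by omega)
  have hn5 : (5 : ℝ) ≤ n := by exact_mod_cast hn
  obtain ⟨i, hi⟩ : ∃ i, ⌊u⌋ = i := ⟨_, rfl⟩
  obtain ⟨j, hj⟩ : ∃ j, ⌊v⌋ = j := ⟨_, rfl⟩
  obtain ⟨p, hp⟩ : ∃ p, Int.fract u = p := ⟨_, rfl⟩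
  obtain ⟨q, hq⟩ : ∃ q, Int.fract v = q := ⟨_, rfl⟩
  have hp0 : 0 ≤ p := hp ▸ Int.fract_nonneg u
  have hq0 : 0 ≤ q := hq ▸ Int.fract_nonneg v
  have hp1 : p < 1 := hp ▸ Int.fract_lt_one u
  have hq1 : q < 1 := hq ▸ Int.fract_lt_one v
  have hu : u = i + p := by rw [← hi, ← hp, Int.floor_add_fract]
  have hv : v = j + q := by rw [← hj, ← hq, Int.floor_add_fract]
  let S : ℝ → ℝ := fun x => 2 * Real.sin (Real.pi * x / n)
  -- The chord is the average of four chords between vertices, weighted by the fractional parts. Two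
  -- of these have the same direction i + j + 1 and are merged.
  let r : Fin 3 → ℝ := ![(1 - p) * (1 - q) * S (j - i),
    (1 - p) * q * S (j - i + 1) + p * (1 - q) * S (j - i - 1), p * q * S (j - i)]
  let θ : Fin 3 → ℝ := ![i + j, i + j + 1, i + j + 2]
  have hsum : polygon n v - polygon n u = Complex.I * ∑ k, r k * dir n (θ k) := by
    have e1 := dir_sub_dir (n := n) i j
    have e2 := dir_sub_dir (n := n) i (j + 1)
    have e3 := dir_sub_dir (n := n) (i + 1) j
    have e4 := dir_sub_dir (n := n) (i + 1) (j + 1)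
    rw [show (j : ℝ) + 1 - i = j - i + 1 by ring, show (i : ℝ) + (j + 1) = i + j + 1 by ring,
      show (2 : ℝ) * (j + 1) = 2 * j + 2 by ring] at e2
    rw [show (j : ℝ) - (i + 1) = j - i - 1 by ring, show (i : ℝ) + 1 + j = i + j + 1 by ring,
      show (2 : ℝ) * (i + 1) = 2 * i + 2 by ring] at e3
    rw [show (j : ℝ) + 1 - (i + 1) = j - i by ring, show (i : ℝ) + 1 + (j + 1) = i + j + 2 by ring,
      show (2 : ℝ) * (j + 1) = 2 * j + 2 by ring, show (2 : ℝ) * (i + 1) = 2 * i + 2 by ring] at e4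
    rw [polygon, polygon, hi, hj, hp, hq]
    simp only [Fin.sum_univ_three, r, θ, S, Matrix.cons_val]
    push_cast at e1 e2 e3 e4 ⊢
    linear_combination ((1 : ℂ) - p) * (1 - q) * e1 + ((1 : ℂ) - p) * q * e2 + p * (1 - q) * e3 +
      p * q * e4
  have hij : i ≤ j := by rw [← hi, ← hj]; exact Int.floor_mono huv.le
  have hji : j ≤ i + n := by
    rw [← hi, ← hj]
    have := Int.floor_mono hvu.le
    rwa [Int.floor_add_intCast] at this
  have hij' : (i : ℝ) ≤ j := by exact_mod_cast hij
  have hji' : (j : ℝ) ≤ i + n := by exact_mod_cast hji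
  have hS0 : 0 ≤ S (j - i) :=
    mul_nonneg two_pos.le (sin_pi_mul_nonneg hn (by linarith) (by linarith))
  have hS1 : 0 < S 1 := mul_pos two_pos (sin_pi_mul_pos hn one_pos (by linarith))
  have hr02 : 0 ≤ r 0 ∧ 0 ≤ r 2 := by
    constructor
    · exact mul_nonneg (mul_nonneg (by linarith) (by linarith)) hS0
    · exact mul_nonneg (mul_nonneg hp0 hq0) hS0
  -- One summand of the middle weight is negative when j = i or j = i + n. Then u < v, respectively
  -- v < u + n, gives the sign of the total.
  have hr1 : 0 ≤ r 1 ∧ ∃ k, 0 < r k := by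
    rcases eq_or_lt_of_le hij with h | h
    · have e : r 1 = (q - p) * S 1 := by
        simp only [r, S, Matrix.cons_val_one, Matrix.cons_val_zero, h, sub_self, zero_add,
          zero_sub, mul_neg, neg_div, Real.sin_neg]
        ring
      have : 0 < q - p := by
        rw [hu, hv, h] at huv
        linarith
      rw [e]
      exact ⟨by positivity, 1, by rw [e]; positivity⟩
    rcases eq_or_lt_of_le hji with h' | h'
    · have hj' : (j : ℝ) = i + n := by exact_mod_cast h'
      have e : r 1 = (p - q) * S 1 := by
        simp only [r, S, Matrix.cons_val_one, Matrix.cons_val_zero, hj']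
        rw [show Real.pi * ((i : ℝ) + n - i + 1) / n = Real.pi * 1 / n + Real.pi by
          field_simp; ring,
          show Real.pi * ((i : ℝ) + n - i - 1) / n = Real.pi - Real.pi * 1 / n by
          field_simp; ring, Real.sin_add_pi, Real.sin_pi_sub]
        ring
      have : 0 < p - q := by
        rw [hu, hv, hj'] at hvu
        linarith
      rw [e]
      exact ⟨by positivity, 1, by rw [e]; positivity⟩
    · have hlt : (i : ℝ) + 1 ≤ j := by exact_mod_cast h
      have hlt' : (j : ℝ) + 1 ≤ i + n := by exact_mod_cast h'
      constructor
      · have s1 : 0 ≤ S (j - i + 1) :=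
          mul_nonneg two_pos.le (sin_pi_mul_nonneg hn (by linarith) (by linarith))
        have s2 : 0 ≤ S (j - i - 1) :=
          mul_nonneg two_pos.le (sin_pi_mul_nonneg hn (by linarith) (by linarith))
        exact add_nonneg (mul_nonneg (mul_nonneg (by linarith) hq0) s1)
          (mul_nonneg (mul_nonneg hp0 (by linarith)) s2)
      · refine ⟨0, mul_pos (mul_pos (by linarith) (by linarith)) ?_⟩
        exact mul_pos two_pos (sin_pi_mul_pos hn (by linarith) (by linarith))
  have hceil : ∀ x : ℝ, Int.fract x ≠ 0 → (⌈x⌉ : ℝ) = ⌊x⌋ + 1 := fun x hx => by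
    exact_mod_cast (Int.ceil_eq_floor_add_one_iff_notMem x).2 fun ⟨m, hm⟩ => hx (by
      rw [← hm, Int.fract_intCast])
  have hcu : (⌊u⌋ : ℝ) ≤ ⌈u⌉ := by exact_mod_cast Int.floor_le_ceil u
  have hcv : (⌊v⌋ : ℝ) ≤ ⌈v⌉ := by exact_mod_cast Int.floor_le_ceil v
  have hcu' : (⌈u⌉ : ℝ) ≤ ⌊u⌋ + 1 := by exact_mod_cast Int.ceil_le_floor_add_one u
  have hcv' : (⌈v⌉ : ℝ) ≤ ⌊v⌋ + 1 := by exact_mod_cast Int.ceil_le_floor_add_one v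
  obtain ⟨ρ, ϑ, hρ, hL, hU, h⟩ := exists_sum_dir_eq Finset.univ r θ (L := ⌊u⌋ + ⌊v⌋)
    (U := ⌈u⌉ + ⌈v⌉) hn (by linarith) (fun k _ => by
      fin_cases k
      exacts [hr02.1, hr1.1, hr02.2]) (fun k _ hk => by
      fin_cases k
      · simp only [θ, Fin.zero_eta, Matrix.cons_val_zero]
        rw [← hi, ← hj]
        constructor <;> linarith
      · simp only [θ, Fin.mk_one, Matrix.cons_val_one, Matrix.cons_val_zero]
        rw [← hi, ← hj]
        refine ⟨by linarith, ?_⟩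
        -- The ceilings matter when an endpoint is a vertex: a direction beyond the upper bound then
        -- has weight zero.
        by_cases h0 : p = 0
        · have h0' : q ≠ 0 := by
            rintro rfl
            exact hk (by simp [r, h0])
          rw [hceil v (hq ▸ h0')]
          linarith
        · rw [hceil u (hp ▸ h0)]
          linarith
      · simp only [θ, Fin.reduceFinMk, Matrix.cons_val]
        rw [← hi, ← hj]
        refine ⟨by linarith, ?_⟩
        have h0 : p ≠ 0 := by
          rintro rfl
          exact hk (by simp [r])
        have h0' : q ≠ 0 := by
          rintro rfl
          exact hk (by simp [r])
        rw [hceil u (hp ▸ h0), hceil v (hq ▸ h0')]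
        linarith)
    (hr1.2.imp fun k hk => ⟨Finset.mem_univ _, hk⟩)
  refine ⟨ρ, ϑ, hρ, hL, hU, ?_⟩
  rw [hsum, h]
  ring

lemma polygon_ne_polygon (hn : 4 < n) {u v : ℝ} (huv : u < v) (hvu : v < u + n) :
    polygon n u ≠ polygon n v := by
  intro h
  obtain ⟨r, θ, hr, -, -, e⟩ := exists_polygon_sub_eq hn huv hvu
  rw [h, sub_self] at e
  have h1 : (r : ℂ) ≠ 0 := by exact_mod_cast hr.ne'
  exact mul_ne_zero h1 (mul_ne_zero Complex.I_ne_zero (dir_ne_zero θ)) e.symm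

lemma exists_int_shift (hn : 4 < n) (x y : ℝ) : ∃ p : ℤ, x ≤ y + p * n ∧ y + p * n < x + n := by
  have hn' : (0 : ℝ) < n := by exact_mod_cast (show 0 < n by omega)
  refine ⟨⌈(x - y) / n⌉, ?_, ?_⟩
  · have := (div_le_iff₀ hn').1 (Int.le_ceil ((x - y) / n))
    linarith
  · have := mul_lt_mul_of_pos_right (Int.ceil_lt_add_one ((x - y) / n)) hn'
    rw [add_mul, div_mul_cancel₀ _ hn'.ne'] at this
    linarith

lemma exists_eq_add_of_polygon_eq (hn : 4 < n) {u v : ℝ} (h : polygon n u = polygon n v) :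
    ∃ p : ℤ, u = v + p * n := by
  obtain ⟨p, h1, h2⟩ := exists_int_shift hn u v
  rcases eq_or_lt_of_le h1 with h3 | h3
  · exact ⟨p, h3⟩
  · exact absurd (by rw [polygon_add_mul hn, h]) (polygon_ne_polygon hn h3 h2)

end Chords

/-! ### Horizontal sections and absence of self-intersections. -/

/-- The staircase curve in the parameter plane which describes the sections of a ploid by
horizontal planes: the section at height `t` of the triangles `A_k A_{k+1} B_{k-δ}` and
`B_{k-δ} A_{k+1} B_{k+1-δ}` consists of the points `(1 - t) A(X) + t B(Y)` for `(X, Y)` on it. -/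
def Stair (δ : ℤ) (X Y : ℝ) : Prop :=
  ∃ k : ℤ, (k ≤ X ∧ X ≤ k + 1 ∧ Y = k - δ) ∨ (X = k + 1 ∧ k - δ ≤ Y ∧ Y ≤ k + 1 - δ)

section Stairs

variable {δ : ℤ} {X Y X' Y' : ℝ}

lemma Stair.add (h : Stair δ X Y) (m : ℤ) : Stair δ (X + m) (Y + m) := by
  obtain ⟨k, h⟩ := h
  refine ⟨k + m, ?_⟩
  push_cast
  rcases h with ⟨h1, h2, h3⟩ | ⟨h1, h2, h3⟩
  · exact Or.inl ⟨by linarith, by linarith, by linarith⟩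
  · exact Or.inr ⟨by linarith, by linarith, by linarith⟩

/-- On each step one coordinate is an integer and the other runs through a unit interval. The two
corner differences of this integer box are the slack in comparing chord directions. -/
lemma Stair.bounds (h : Stair δ X Y) : ∃ k l u v : ℤ, (k : ℝ) ≤ X ∧ X ≤ l ∧ u ≤ Y ∧ Y ≤ v ∧
    k - v = δ ∧ l - u = δ + 1 := by
  obtain ⟨k, h⟩ := h
  rcases h with ⟨h1, h2, h3⟩ | ⟨h1, h2, h3⟩
  · refine ⟨k, k + 1, k - δ, k - δ, h1, ?_, ?_, ?_, by ring, by ring⟩ <;> push_cast <;> linarith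
  · refine ⟨k + 1, k + 1, k - δ, k + 1 - δ, ?_, ?_, ?_, ?_, by ring, by ring⟩ <;> push_cast <;>
      linarith

lemma Stair.sub_mem (h : Stair δ X Y) : (δ : ℝ) ≤ X - Y ∧ X - Y ≤ δ + 1 := by
  obtain ⟨k, h⟩ := h
  rcases h with ⟨h1, h2, h3⟩ | ⟨h1, h2, h3⟩ <;> constructor <;> linarith

lemma Stair.mono (h : Stair δ X Y) (h' : Stair δ X' Y') (hX : X' < X) : Y' ≤ Y := by
  obtain ⟨k, h⟩ := h
  obtain ⟨k', h'⟩ := h'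
  have hk : k' ≤ k := by
    have : (k' : ℝ) < k + 1 := by
      rcases h with ⟨h1, h2, h3⟩ | ⟨h1, h2, h3⟩ <;> rcases h' with ⟨h1', h2', h3'⟩ | ⟨h1', h2', h3'⟩ <;>
        linarith
    have : k' < k + 1 := by exact_mod_cast this
    omega
  rcases eq_or_lt_of_le hk with rfl | hk
  · rcases h with ⟨h1, h2, h3⟩ | ⟨h1, h2, h3⟩ <;> rcases h' with ⟨h1', h2', h3'⟩ | ⟨h1', h2', h3'⟩ <;>
      linarith
  · have : (k' : ℝ) + 1 ≤ k := by exact_mod_cast hk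
    rcases h with ⟨h1, h2, h3⟩ | ⟨h1, h2, h3⟩ <;> rcases h' with ⟨h1', h2', h3'⟩ | ⟨h1', h2', h3'⟩ <;>
      linarith

lemma int_mul_cases {n : ℤ} (hn : 4 < n) (p : ℤ) :
    p = 0 ∨ (n : ℝ) ≤ p * n ∨ (p : ℝ) * n ≤ -n := by
  have hn' : (0 : ℝ) < n := by exact_mod_cast (show 0 < n by omega)
  rcases lt_trichotomy p 0 with h | h | h
  · right; right
    have : (p : ℝ) ≤ -1 := by exact_mod_cast (show p ≤ -1 by omega)
    nlinarith
  · exact Or.inl h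
  · right; left
    have : (1 : ℝ) ≤ p := by exact_mod_cast h
    nlinarith

variable {n d : ℤ} {a t : ℝ} {δ' : ℤ}

/-- The sections of the two ploids of a diplotorus by a horizontal plane strictly between the planes
of the two polygons are disjoint and have no self-intersections. -/
lemma stair_injective (hn : 4 < n) (hd : 2 ≤ d) (hdn : d < n - 2) (hda : (d : ℝ) + 1 < a)
    (han : a < n - 1) (ht0 : 0 < t) (ht1 : t < 1) (hδ : δ = 0 ∨ δ = d) (hδ' : δ' = 0 ∨ δ' = d)
    (h : Stair δ X Y) (h' : Stair δ' X' Y')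
    (heq : (1 - t : ℝ) * polygon n X + (t : ℝ) * (dir n (a + 1) * polygon n Y) =
      (1 - t : ℝ) * polygon n X' + (t : ℝ) * (dir n (a + 1) * polygon n Y')) :
    δ = δ' ∧ ∃ p : ℤ, X = X' + p * n ∧ Y = Y' + p * n := by
  have hn0 : (0 : ℝ) < n := by exact_mod_cast (show 0 < n by omega)
  have hd' : (2 : ℝ) ≤ d := by exact_mod_cast hd
  have hdn' : (d : ℝ) + 3 ≤ n := by exact_mod_cast (show d + 3 ≤ n by omega)
  have ht1' : ((1 - t : ℝ) : ℂ) ≠ 0 := by exact_mod_cast (by linarith : (1 : ℝ) - t ≠ 0)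
  have ht0' : (t : ℂ) ≠ 0 := by exact_mod_cast ht0.ne'
  obtain ⟨p₀, hp₀, hp₀'⟩ := exists_int_shift hn X' X
  -- Shifting both coordinates by a multiple of n, one may assume X' ≤ X < X' + n.
  wlog hzero : p₀ = 0 generalizing X' Y' p₀
  · have e : ((-p₀ * n : ℤ) : ℝ) = -(p₀ * n) := by push_cast; ring
    have e' : ((-p₀ * n : ℤ) : ℝ) = ((-p₀ : ℤ) : ℝ) * n := by push_cast; ring
    obtain ⟨h1, p, h2, h3⟩ := this (h'.add (-p₀ * n))
      (by rw [heq, e', polygon_add_mul hn, polygon_add_mul hn]) 0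
      (by rw [e]; push_cast; linarith) (by rw [e]; push_cast; linarith) rfl
    refine ⟨h1, p - p₀, ?_, ?_⟩
    · rw [h2]; push_cast; ring
    · rw [h3]; push_cast; ring
  subst hzero
  simp only [Int.cast_zero, zero_mul, add_zero] at hp₀ hp₀'
  obtain ⟨p, hp, hp'⟩ := exists_int_shift hn Y Y'
  have hYp : polygon n (Y' + p * n) = polygon n Y' := polygon_add_mul hn _ _
  have heq' : (1 - t : ℝ) * (polygon n X - polygon n X') =
      (t : ℝ) * (dir n (a + 1) * (polygon n (Y' + p * n) - polygon n Y)) := by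
    rw [hYp]
    linear_combination heq
  have b := h.sub_mem
  have b' := h'.sub_mem
  rcases eq_or_lt_of_le hp₀ with hX | hX
  · have hYY : Y = Y' + p * n := by
      rcases eq_or_lt_of_le hp with h3 | h3
      · exact h3
      · rw [hX, sub_self, mul_zero] at heq'
        have := mul_eq_zero.1 heq'.symm
        simp only [ht0', mul_eq_zero, dir_ne_zero, false_or] at this
        exact absurd (sub_eq_zero.1 this).symm (polygon_ne_polygon hn h3 hp')
    -- X - Y and X' - Y' lie in unit intervals starting at δ and δ' and differ by a multiple of n.
    -- As 2 ≤ d ≤ n - 3, this leaves no other case.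
    have hboth : p = 0 ∧ δ = δ' := by
      rcases hδ with rfl | rfl <;> rcases hδ' with rfl | rfl <;>
        rcases int_mul_cases hn p with rfl | hpn | hpn <;> push_cast at * <;>
        first
          | (exfalso; linarith)
          | simp
    obtain ⟨rfl, rfl⟩ := hboth
    exact ⟨rfl, 0, by simp [hX], by simpa using hYY⟩
  exfalso
  have hXn : X < X' + n := hp₀'
  obtain ⟨r, θ, hr, hθ1, hθ2, e1⟩ := exists_polygon_sub_eq hn hX hXn
  rcases eq_or_lt_of_le hp with h3 | h3
  · rw [← h3, sub_self, mul_zero, mul_zero] at heq'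
    rcases mul_eq_zero.1 heq' with h4 | h4
    · exact ht1' h4
    · exact polygon_ne_polygon hn hX hXn (sub_eq_zero.1 h4).symm
  obtain ⟨r', θ', hr', hθ1', hθ2', e2⟩ := exists_polygon_sub_eq hn h3 hp'
  rw [e1, e2] at heq'
  have heq2 : (((1 - t) * r : ℝ) : ℂ) * dir n θ = ((t * r' : ℝ) : ℂ) * dir n (a + 1 + θ') := by
    rw [dir_add]
    apply mul_left_cancel₀ Complex.I_ne_zero
    push_cast at heq' ⊢
    linear_combination heq'
  -- The chords have the same orientation as well as the same line, so their directions agree modulo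
  -- 2n and not only modulo n. This is what preserves the parity of N = 2q + p.
  obtain ⟨q, hq⟩ := eq_add_of_mul_dir_eq hn (mul_pos (by linarith) hr) (mul_pos ht0 hr') heq2
  obtain ⟨k, l, u, v, h1, h2, h4, h5, h6, h7⟩ := h.bounds
  obtain ⟨k', l', u', v', h1', h2', h4', h5', h6', h7'⟩ := h'.bounds
  have c1 : (k : ℝ) ≤ ⌊X⌋ := by exact_mod_cast Int.le_floor.2 h1
  have c1' : (k' : ℝ) ≤ ⌊X'⌋ := by exact_mod_cast Int.le_floor.2 h1'
  have c2 : (⌈X⌉ : ℝ) ≤ l := by exact_mod_cast Int.ceil_le.2 h2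
  have c2' : (⌈X'⌉ : ℝ) ≤ l' := by exact_mod_cast Int.ceil_le.2 h2'
  have c3 : (u : ℝ) ≤ ⌊Y⌋ := by exact_mod_cast Int.le_floor.2 h4
  have c4 : (⌈Y⌉ : ℝ) ≤ v := by exact_mod_cast Int.ceil_le.2 h5
  have c3' : (u' : ℝ) + p * n ≤ ⌊Y' + p * n⌋ := by
    have : u' + p * n ≤ ⌊Y' + p * n⌋ := Int.le_floor.2 (by push_cast; linarith)
    exact_mod_cast this
  have c4' : (⌈Y' + p * n⌉ : ℝ) ≤ v' + p * n := by
    have : ⌈Y' + p * n⌉ ≤ v' + p * n := Int.ceil_le.2 (by push_cast; linarith)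
    exact_mod_cast this
  have r6 : (k : ℝ) - v = δ := by exact_mod_cast h6
  have r7 : (l : ℝ) - u = δ + 1 := by exact_mod_cast h7
  have r6' : (k' : ℝ) - v' = δ' := by exact_mod_cast h6'
  have r7' : (l' : ℝ) - u' = δ' + 1 := by exact_mod_cast h7'
  have eN : ((2 * q + p : ℤ) : ℝ) * n = 2 * (q * n) + p * n := by push_cast; ring
  have lower : (δ : ℝ) + δ' ≤ a + 1 + ((2 * q + p : ℤ) : ℝ) * n := by
    rw [eN]; linarith
  have upper : a + 1 + ((2 * q + p : ℤ) : ℝ) * n ≤ δ + δ' + 2 := by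
    rw [eN]; linarith
  -- Only here could N = 0 satisfy both bounds. Monotonicity gives Y' ≤ Y ≤ Y' + n, hence p = 1 and
  -- N is odd; the bounds a + 1 > d + 2, n > d + 2 and a + 1 < n exclude the other values.
  by_cases hdd : δ = d ∧ δ' = d
  · obtain ⟨rfl, rfl⟩ := hdd
    have m1 := h.mono h' hX
    have m2 : Y ≤ Y' + n := (h'.add n).mono h hXn
    have hp1 : p = 1 := by
      rcases int_mul_cases hn p with rfl | hpn | hpn
      · simp at h3; linarith
      · rcases int_mul_cases hn (p - 1) with hh | hh | hh
        · omega
        · push_cast at hh; linarith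
        · push_cast at hh; linarith
      · linarith
    subst hp1
    rcases int_mul_cases hn (2 * q + 1) with hN | hN | hN
    · omega
    · linarith
    · linarith
  · rcases int_mul_cases hn (2 * q + p) with hN | hN | hN
    · rw [hN] at lower upper
      rcases hδ with rfl | rfl <;> rcases hδ' with rfl | rfl <;> push_cast at * <;>
        first
          | linarith
          | exact hdd ⟨rfl, rfl⟩
    · rcases hδ with rfl | rfl <;> rcases hδ' with rfl | rfl <;> push_cast at * <;> linarith
    · rcases hδ with rfl | rfl <;> rcases hδ' with rfl | rfl <;> push_cast at * <;> linarith

end Stairs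

/-! ### The universal cover of the diplotorus. -/

/-- The vertices of the universal cover of a diplotorus, indexed by `ℤ × ℤ` in such a way that its
triangles are those of the standard triangulation. The even rows consist of the vertices `A_k`, the
odd rows of the vertices `B_k`. -/
def surfaceVertex (n d : ℤ) (a h : ℝ) (v : ℤ × ℤ) : E3 :=
  if Even v.2 then vertexA n (v.1 + v.2 / 2 * (1 - d))
  else vertexB n a h (v.1 - d + v.2 / 2 * (1 - d))

/-- The group of translations of `ℤ × ℤ` under which a diplotorus is invariant. -/
def deckGroup (n d : ℤ) : AddSubgroup (ℤ × ℤ) := AddSubgroup.closure {(n, 0), (d - 1, 2)}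

/-- The horizontal projection of space, as a complex number. -/
def horizontal : E3 →ₗ[ℝ] ℂ where
  toFun q := q 0 + q 1 * Complex.I
  map_add' q q' := by simp; ring
  map_smul' r q := by simp; ring

/-- The height of a point of space. -/
def height : E3 →ₗ[ℝ] ℝ where
  toFun q := q 2
  map_add' q q' := by simp
  map_smul' r q := by simp

section Surface

variable {n d : ℤ} {a h : ℝ}

lemma surfaceVertex_even (k m : ℤ) :
    surfaceVertex n d a h (k, 2 * m) = vertexA n (k + m * (1 - d)) := by
  simp [surfaceVertex]

lemma surfaceVertex_odd (k m : ℤ) :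
    surfaceVertex n d a h (k, 2 * m + 1) = vertexB n a h (k - d + m * (1 - d)) := by
  have h1 : ¬ Even (2 * m + 1) := by simp
  have h2 : (2 * m + 1) / 2 = m := by omega
  simp only [surfaceVertex, h1, if_false, h2]

lemma mem_deckGroup_iff {γ : ℤ × ℤ} :
    γ ∈ deckGroup n d ↔ ∃ p m : ℤ, γ = (p * n + m * (d - 1), 2 * m) := by
  rw [deckGroup, AddSubgroup.mem_closure_pair]
  constructor
  · rintro ⟨p, m, rfl⟩
    exact ⟨p, m, by ext <;> simp; ring⟩
  · rintro ⟨p, m, rfl⟩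
    exact ⟨p, m, by ext <;> simp; ring⟩

lemma vertexA_add_mul (hn : 4 < n) (k p : ℤ) : vertexA n (k + p * n) = vertexA n k := by
  have hn' : (n : ℝ) ≠ 0 := by exact_mod_cast (show n ≠ 0 by omega)
  have e : 2 * Real.pi * ((k + p * n : ℤ) : ℝ) / n = 2 * Real.pi * k / n + p * (2 * Real.pi) := by
    push_cast; field_simp
  rw [vertexA, vertexA, e, Real.cos_add_int_mul_two_pi, Real.sin_add_int_mul_two_pi]

lemma vertexB_add_mul (hn : 4 < n) (k p : ℤ) : vertexB n a h (k + p * n) = vertexB n a h k := by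
  have hn' : (n : ℝ) ≠ 0 := by exact_mod_cast (show n ≠ 0 by omega)
  have e : Real.pi / n * (a + 1 + 2 * ((k + p * n : ℤ) : ℝ)) =
      Real.pi / n * (a + 1 + 2 * k) + p * (2 * Real.pi) := by
    push_cast; field_simp; ring
  rw [vertexB, vertexB, e, Real.cos_add_int_mul_two_pi, Real.sin_add_int_mul_two_pi]

lemma surfaceVertex_add (hn : 4 < n) {γ : ℤ × ℤ} (hγ : γ ∈ deckGroup n d) (v : ℤ × ℤ) :
    surfaceVertex n d a h (v + γ) = surfaceVertex n d a h v := by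
  obtain ⟨p, m, rfl⟩ := mem_deckGroup_iff.1 hγ
  obtain ⟨k, j⟩ := v
  rcases Int.even_or_odd' j with ⟨l, rfl | rfl⟩
  · rw [Prod.mk_add_mk, show 2 * l + 2 * m = 2 * (l + m) by ring, surfaceVertex_even,
      surfaceVertex_even, ← vertexA_add_mul hn (k + l * (1 - d)) p]
    congr 1
    ring
  · rw [Prod.mk_add_mk, show 2 * l + 1 + 2 * m = 2 * (l + m) + 1 by ring, surfaceVertex_odd,
      surfaceVertex_odd, ← vertexB_add_mul hn (k - d + l * (1 - d)) p]
    congr 1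
    ring

lemma horizontal_vertexA (k : ℤ) : horizontal (vertexA n k) = dir n (2 * k) := by
  rw [dir_eq, show Real.pi * (2 * k) / n = 2 * Real.pi * k / n by ring]
  simp [horizontal, vertexA]

lemma horizontal_vertexB (k : ℤ) :
    horizontal (vertexB n a h k) = dir n (a + 1) * dir n (2 * k) := by
  rw [← dir_add, dir_eq, show Real.pi * (a + 1 + 2 * k) / n = Real.pi / n * (a + 1 + 2 * k) by ring]
  simp [horizontal, vertexB]

lemma height_vertexA (k : ℤ) : height (vertexA n k) = 0 := by
  change vertexA n k 2 = 0
  simp [vertexA]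

lemma height_vertexB (k : ℤ) : height (vertexB n a h k) = h := by
  change vertexB n a h k 2 = h
  simp [vertexB]

lemma mul_polygon_eq {k : ℤ} {w w' s : ℝ} (hs : 0 < s) (hw : 0 ≤ w) (hw' : 0 ≤ w')
    (hsum : w + w' = s) :
    (s : ℂ) * polygon n (k + w' / s) = w * dir n (2 * k) + w' * dir n (2 * (k + 1 : ℤ)) := by
  have h1 : w' / s ≤ 1 := by rw [div_le_one hs]; linarith
  have h0 : 0 ≤ w' / s := by positivity
  rw [polygon_eq (k := k) (by linarith) (by linarith), add_sub_cancel_left]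
  have hs' : (s : ℂ) ≠ 0 := by exact_mod_cast hs.ne'
  have hw'' : (w : ℂ) = s - w' := by rw [← hsum]; push_cast; ring
  rw [hw'']
  push_cast
  rw [show (2 : ℝ) * (k + 1) = 2 * k + 2 by ring]
  field_simp

/-- The points of the universal cover of a diplotorus in terms of the staircase curves. -/
lemma exists_stair (p : ℝ × ℝ) : ∃ (m δ : ℤ) (t X Y : ℝ), Stair δ X Y ∧
    horizontal (interp (surfaceVertex n d a h) p) =
      (1 - t : ℝ) * polygon n X + (t : ℝ) * (dir n (a + 1) * polygon n Y) ∧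
    height (interp (surfaceVertex n d a h) p) = t * h ∧
    ((δ = d ∧ 0 ≤ t ∧ t < 1 ∧ p.2 = 2 * m + t ∧
        p.1 + m * (1 - d) = (1 - t) * X + t * (Y + d)) ∨
      (δ = 0 ∧ 0 < t ∧ t ≤ 1 ∧ p.2 = 2 * m - t ∧
        p.1 + m * (1 - d) = (1 - t) * X + t * (Y + 1))) := by
  obtain ⟨i, hi⟩ : ∃ i, ⌊p.1⌋ = i := ⟨_, rfl⟩
  obtain ⟨j, hj⟩ : ∃ j, ⌊p.2⌋ = j := ⟨_, rfl⟩
  obtain ⟨α, hα⟩ : ∃ α, Int.fract p.1 = α := ⟨_, rfl⟩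
  obtain ⟨β, hβ⟩ : ∃ β, Int.fract p.2 = β := ⟨_, rfl⟩
  have hα0 : 0 ≤ α := hα ▸ Int.fract_nonneg _
  have hβ0 : 0 ≤ β := hβ ▸ Int.fract_nonneg _
  have hα1 : α < 1 := hα ▸ Int.fract_lt_one _
  have hβ1 : β < 1 := hβ ▸ Int.fract_lt_one _
  have hp1 : p.1 = i + α := by rw [← hi, ← hα, Int.floor_add_fract]
  have hp2 : p.2 = j + β := by rw [← hj, ← hβ, Int.floor_add_fract]
  have hβ1' : 0 < 1 - β := by linarith
  -- The strip above an even row belongs to the external ploid and rises, so t = β. The strip above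
  -- an odd row belongs to the internal ploid and descends to row 2(m + 1), so t = 1 - β. The
  -- half-open ranges assign t = 0 to δ = d only and t = 1 to δ = 0 only.
  rcases Int.even_or_odd' j with ⟨m, rfl | rfl⟩
  · by_cases hle : α + β ≤ 1
    · refine ⟨m, d, β, ((i + m * (1 - d) : ℤ) : ℝ) + α / (1 - β), ((i + m * (1 - d) - d : ℤ) : ℝ),
        ⟨i + m * (1 - d), Or.inl ⟨?_, ?_, ?_⟩⟩, ?_, ?_, Or.inl ⟨rfl, hβ0, hβ1, ?_, ?_⟩⟩
      · have : 0 ≤ α / (1 - β) := by positivity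
        linarith
      · have : α / (1 - β) ≤ 1 := by rw [div_le_one hβ1']; linarith
        linarith
      · push_cast; ring
      · rw [mul_polygon_eq hβ1' (w := 1 - α - β) (by linarith) hα0 (by ring),
          polygon, Int.floor_intCast, Int.fract_intCast]
        simp only [interp, hi, hj, hα, hβ, if_pos hle, map_add, map_smul, surfaceVertex_even,
          surfaceVertex_odd, horizontal_vertexA, horizontal_vertexB, Complex.real_smul]
        rw [show i + 1 + m * (1 - d) = i + m * (1 - d) + 1 by ring,
          show i - d + m * (1 - d) = i + m * (1 - d) - d by ring]
        push_cast
        ring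
      · simp only [interp, hi, hj, hα, hβ, if_pos hle, map_add, map_smul, surfaceVertex_even,
          surfaceVertex_odd, height_vertexA, height_vertexB, smul_eq_mul]
        ring
      · rw [hp2]; push_cast; ring
      · rw [hp1]; push_cast; field_simp; ring
    · have hβ' : 0 < β := by linarith
      refine ⟨m, d, β, ((i + m * (1 - d) + 1 : ℤ) : ℝ),
        ((i + m * (1 - d) - d : ℤ) : ℝ) + (α + β - 1) / β,
        ⟨i + m * (1 - d), Or.inr ⟨?_, ?_, ?_⟩⟩, ?_, ?_, Or.inl ⟨rfl, hβ0, hβ1, ?_, ?_⟩⟩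
      · push_cast; ring
      · have : 0 ≤ (α + β - 1) / β := div_nonneg (by linarith) hβ'.le
        push_cast; linarith
      · have : (α + β - 1) / β ≤ 1 := by rw [div_le_one hβ']; linarith
        push_cast; linarith
      · have e := mul_polygon_eq (n := n) (k := i + m * (1 - d) - d) hβ' (w := 1 - α)
          (w' := α + β - 1) (by linarith) (by linarith) (by ring)
        rw [mul_left_comm, e, polygon, Int.floor_intCast, Int.fract_intCast]
        simp only [interp, hi, hj, hα, hβ, if_neg hle, map_add, map_smul, surfaceVertex_even,
          surfaceVertex_odd, horizontal_vertexA, horizontal_vertexB, Complex.real_smul]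
        rw [show i + 1 + m * (1 - d) = i + m * (1 - d) + 1 by ring,
          show i - d + m * (1 - d) = i + m * (1 - d) - d by ring,
          show i + 1 - d + m * (1 - d) = i + m * (1 - d) - d + 1 by ring]
        push_cast
        ring
      · simp only [interp, hi, hj, hα, hβ, if_neg hle, map_add, map_smul, surfaceVertex_even,
          surfaceVertex_odd, height_vertexA, height_vertexB, smul_eq_mul]
        ring
      · rw [hp2]; push_cast; ring
      · rw [hp1]; push_cast; field_simp; ring
  · have ej : 2 * m + 1 + 1 = 2 * (m + 1) := by ring
    by_cases hle : α + β ≤ 1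
    · refine ⟨m + 1, 0, 1 - β, ((i - d + m * (1 - d) + 1 : ℤ) : ℝ),
        ((i - d + m * (1 - d) : ℤ) : ℝ) + α / (1 - β),
        ⟨i - d + m * (1 - d), Or.inr ⟨?_, ?_, ?_⟩⟩, ?_, ?_,
        Or.inr ⟨rfl, hβ1', by linarith, ?_, ?_⟩⟩
      · push_cast; ring
      · have : 0 ≤ α / (1 - β) := by positivity
        push_cast; linarith
      · have : α / (1 - β) ≤ 1 := by rw [div_le_one hβ1']; linarith
        push_cast; linarith
      · have e := mul_polygon_eq (n := n) (k := i - d + m * (1 - d)) hβ1' (w := 1 - α - β)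
          (w' := α) (by linarith) (by linarith) (by ring)
        rw [mul_left_comm, e, polygon, Int.floor_intCast, Int.fract_intCast]
        simp only [interp, hi, hj, hα, hβ, if_pos hle, map_add, map_smul, surfaceVertex_even,
          surfaceVertex_odd, horizontal_vertexA, horizontal_vertexB, Complex.real_smul, ej]
        rw [show i + (m + 1) * (1 - d) = i - d + m * (1 - d) + 1 by ring,
          show i + 1 - d + m * (1 - d) = i - d + m * (1 - d) + 1 by ring]
        push_cast
        ring
      · simp only [interp, hi, hj, hα, hβ, if_pos hle, map_add, map_smul, surfaceVertex_even,
          surfaceVertex_odd, height_vertexA, height_vertexB, smul_eq_mul, ej]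
        ring
      · rw [hp2]; push_cast; ring
      · rw [hp1]; push_cast; field_simp; ring
    · have hβ' : 0 < β := by linarith
      refine ⟨m + 1, 0, 1 - β, ((i - d + m * (1 - d) + 1 : ℤ) : ℝ) + (α + β - 1) / β,
        ((i - d + m * (1 - d) + 1 : ℤ) : ℝ),
        ⟨i - d + m * (1 - d) + 1, Or.inl ⟨?_, ?_, ?_⟩⟩, ?_, ?_,
        Or.inr ⟨rfl, hβ1', by linarith, ?_, ?_⟩⟩
      · have : 0 ≤ (α + β - 1) / β := div_nonneg (by linarith) hβ'.le
        push_cast; linarith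
      · have : (α + β - 1) / β ≤ 1 := by rw [div_le_one hβ']; linarith
        push_cast; linarith
      · push_cast; ring
      · rw [show 1 - (1 - β) = β by ring, mul_polygon_eq hβ' (w := 1 - α) (by linarith)
          (by linarith) (by ring), polygon, Int.floor_intCast, Int.fract_intCast]
        simp only [interp, hi, hj, hα, hβ, if_neg hle, map_add, map_smul, surfaceVertex_even,
          surfaceVertex_odd, horizontal_vertexA, horizontal_vertexB, Complex.real_smul, ej]
        rw [show i + (m + 1) * (1 - d) = i - d + m * (1 - d) + 1 by ring,
          show i + 1 - d + m * (1 - d) = i - d + m * (1 - d) + 1 by ring,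
          show i + 1 + (m + 1) * (1 - d) = i - d + m * (1 - d) + 1 + 1 by ring]
        push_cast
        ring
      · simp only [interp, hi, hj, hα, hβ, if_neg hle, map_add, map_smul, surfaceVertex_even,
          surfaceVertex_odd, height_vertexA, height_vertexB, smul_eq_mul, ej]
        ring
      · rw [hp2]; push_cast; ring
      · rw [hp1]; push_cast; field_simp; ring

/-- The diplotorus has no self-intersections. -/
lemma interp_surfaceVertex_injective (hn : 4 < n) (hd : 2 ≤ d) (hdn : d < n - 2)
    (hda : (d : ℝ) + 1 < a) (han : a < n - 1) (hh : 0 < h) (p q : ℝ × ℝ)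
    (heq : interp (surfaceVertex n d a h) p = interp (surfaceVertex n d a h) q) :
    ∃ γ ∈ deckGroup n d, q = p + toPlane γ := by
  obtain ⟨m, δ, t, X, Y, hs, e1, e2, e3⟩ := exists_stair (n := n) (d := d) (a := a) (h := h) p
  obtain ⟨m', δ', t', X', Y', hs', e1', e2', e3'⟩ :=
    exists_stair (n := n) (d := d) (a := a) (h := h) q
  rw [heq, e2'] at e2
  obtain rfl := mul_right_cancel₀ hh.ne' e2
  rw [heq, e1'] at e1
  have hδ : δ = 0 ∨ δ = d := by rcases e3 with e | e <;> simp [e.1]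
  have hδ' : δ' = 0 ∨ δ' = d := by rcases e3' with e | e <;> simp [e.1]
  have hd0 : d ≠ 0 := by omega
  have hfinal : ∀ r : ℤ, p.1 + m * (1 - d) = q.1 + m' * (1 - d) + r * n → p.2 - 2 * m = q.2 - 2 * m' →
      ∃ γ ∈ deckGroup n d, q = p + toPlane γ := by
    intro r h1 h2
    refine ⟨_, mem_deckGroup_iff.2 ⟨-r, m' - m, rfl⟩, ?_⟩
    ext
    · simp only [toPlane, Prod.fst_add]; push_cast; linarith
    · simp only [toPlane, Prod.snd_add]; push_cast; linarith
  have ht : 0 ≤ t' ∧ t' ≤ 1 := by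
    rcases e3 with ⟨-, h1, h2, -⟩ | ⟨-, h1, h2, -⟩ <;> exact ⟨by linarith, by linarith⟩
  -- In the planes of the two polygons the section is a polygon itself, which is injective modulo n;
  -- strictly between them the staircases decide.
  rcases eq_or_lt_of_le ht.1 with rfl | ht0
  · rcases e3 with ⟨-, -, -, h1, h2⟩ | ⟨-, h1, -⟩
    · rcases e3' with ⟨-, -, -, h1', h2'⟩ | ⟨-, h1', -⟩
      · have e4 : polygon n X = polygon n X' := by simpa using e1.symm
        obtain ⟨r, hr⟩ := exists_eq_add_of_polygon_eq hn e4
        exact hfinal r (by linarith) (by linarith)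
      · exact absurd h1' (lt_irrefl _)
    · exact absurd h1 (lt_irrefl _)
  rcases eq_or_lt_of_le ht.2 with rfl | ht1
  · rcases e3 with ⟨-, -, h1, -⟩ | ⟨-, -, -, h1, h2⟩
    · exact absurd h1 (lt_irrefl _)
    · rcases e3' with ⟨-, -, h1', -⟩ | ⟨-, -, -, h1', h2'⟩
      · exact absurd h1' (lt_irrefl _)
      · have e4 : polygon n Y = polygon n Y' := by simpa [dir_ne_zero] using e1.symm
        obtain ⟨r, hr⟩ := exists_eq_add_of_polygon_eq hn e4
        exact hfinal r (by linarith) (by linarith)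
  obtain ⟨rfl, r, rfl, rfl⟩ := stair_injective hn hd hdn hda han ht0 ht1 hδ hδ' hs hs' e1.symm
  rcases e3 with ⟨g, -, -, h1, h2⟩ | ⟨g, -, -, h1, h2⟩ <;>
    rcases e3' with ⟨g', -, -, h1', h2'⟩ | ⟨g', -, -, h1', h2'⟩
  · exact hfinal r (by rw [h2, h2']; ring) (by linarith)
  · exact absurd (g.symm.trans g') hd0
  · exact absurd (g'.symm.trans g) hd0
  · exact hfinal r (by rw [h2, h2']; ring) (by linarith)

/-- By n-periodicity of the vertices the index may range over all integers. -/
lemma mem_diplotorus_iff (hn : 4 < n) {t : Set E3} :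
    t ∈ diplotorus n d a h ↔ ∃ k : ℤ,
      t = {vertexA n k, vertexA n (k + 1), vertexB n a h k} ∨
      t = {vertexB n a h k, vertexA n (k + 1), vertexB n a h (k + 1)} ∨
      t = {vertexA n k, vertexA n (k + 1), vertexB n a h (k - d)} ∨
      t = {vertexB n a h (k - d), vertexA n (k + 1), vertexB n a h (k + 1 - d)} := by
  constructor
  · rintro (⟨k, -, -, h | h⟩ | ⟨k, -, -, h | h⟩)
    exacts [⟨k, by tauto⟩, ⟨k, by tauto⟩, ⟨k, by tauto⟩, ⟨k, by tauto⟩]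
  · rintro ⟨k, hk⟩
    have hA : ∀ c, vertexA n (k + c) = vertexA n (k % n + c) := fun c => by
      rw [← vertexA_add_mul hn (k % n + c) (k / n)]
      congr 1
      linarith [Int.emod_add_mul_ediv k n]
    have hB : ∀ c, vertexB n a h (k + c) = vertexB n a h (k % n + c) := fun c => by
      rw [← vertexB_add_mul hn (k % n + c) (k / n)]
      congr 1
      linarith [Int.emod_add_mul_ediv k n]
    have hA0 := hA 0
    have hB0 := hB 0
    have hB1 := hB (-d)
    have hB2 := hB (1 - d)
    simp only [add_zero] at hA0 hB0
    rw [← sub_eq_add_neg, ← sub_eq_add_neg] at hB1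
    rw [← add_sub_assoc, ← add_sub_assoc] at hB2
    rw [hA0, hB0, hA 1, hB 1, hB1, hB2] at hk
    have h0 := Int.emod_nonneg k (show n ≠ 0 by omega)
    have h1 := Int.emod_lt_of_pos k (show 0 < n by omega)
    rcases hk with hk | hk | hk | hk
    exacts [Or.inl ⟨k % n, h0, h1, by tauto⟩, Or.inl ⟨k % n, h0, h1, by tauto⟩,
      Or.inr ⟨k % n, h0, h1, by tauto⟩, Or.inr ⟨k % n, h0, h1, by tauto⟩]

lemma finite_diplotorus : (diplotorus n d a h).Finite := by
  have hk : {k : ℤ | 0 ≤ k ∧ k < n}.Finite := Set.finite_Ico 0 n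
  refine Set.Finite.union ?_ ?_
  · refine ((hk.image fun k => ({vertexA n k, vertexA n (k + 1), vertexB n a h k} : Set E3)).union
      (hk.image fun k => ({vertexB n a h k, vertexA n (k + 1), vertexB n a h (k + 1)} :
        Set E3))).subset ?_
    rintro t ⟨k, h0, h1, rfl | rfl⟩
    exacts [Or.inl ⟨k, ⟨h0, h1⟩, rfl⟩, Or.inr ⟨k, ⟨h0, h1⟩, rfl⟩]
  · refine ((hk.image fun k =>
      ({vertexA n k, vertexA n (k + 1), vertexB n a h (k - d)} : Set E3)).union
      (hk.image fun k => ({vertexB n a h (k - d), vertexA n (k + 1), vertexB n a h (k + 1 - d)} :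
        Set E3))).subset ?_
    rintro t ⟨k, h0, h1, rfl | rfl⟩
    exacts [Or.inl ⟨k, ⟨h0, h1⟩, rfl⟩, Or.inr ⟨k, ⟨h0, h1⟩, rfl⟩]

lemma range_comp_latticeTriangle {E : Type*} (V : ℤ × ℤ → E) (v : ℤ × ℤ) (ε : ℤˣ) :
    Set.range (V ∘ latticeTriangle v ε) = {V v, V (v.1 + ε, v.2), V (v.1, v.2 + ε)} := by
  ext x
  simp [Fin.exists_fin_succ, latticeTriangle, eq_comm]

/-- The four families of triangles correspond to the four combinations of the parity of the row and
the sign ε. -/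
lemma mem_diplotorus_iff_exists_latticeTriangle (hn : 4 < n) (t : Set E3) :
    t ∈ diplotorus n d a h ↔
      ∃ v ε, t = Set.range (surfaceVertex n d a h ∘ latticeTriangle v ε) := by
  rw [mem_diplotorus_iff hn]
  have h1 : ∀ k m : ℤ, Set.range (surfaceVertex n d a h ∘ latticeTriangle (k, 2 * m) 1) =
      {vertexA n (k + m * (1 - d)), vertexA n (k + m * (1 - d) + 1),
        vertexB n a h (k + m * (1 - d) - d)} := by
    intro k m
    rw [range_comp_latticeTriangle]
    simp only [Units.val_one, surfaceVertex_even, surfaceVertex_odd]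
    rw [show k + 1 + m * (1 - d) = k + m * (1 - d) + 1 by ring,
      show k - d + m * (1 - d) = k + m * (1 - d) - d by ring]
  have h2 : ∀ k m : ℤ, Set.range (surfaceVertex n d a h ∘ latticeTriangle (k, 2 * m + 1) 1) =
      {vertexB n a h (k - d + m * (1 - d)), vertexA n (k - d + m * (1 - d) + 1),
        vertexB n a h (k - d + m * (1 - d) + 1)} := by
    intro k m
    rw [range_comp_latticeTriangle]
    simp only [Units.val_one, surfaceVertex_odd]
    rw [show 2 * m + 1 + 1 = 2 * (m + 1) by ring, surfaceVertex_even,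
      show k + (m + 1) * (1 - d) = k - d + m * (1 - d) + 1 by ring,
      show k + 1 - d + m * (1 - d) = k - d + m * (1 - d) + 1 by ring, Set.pair_comm]
  have h3 : ∀ k m : ℤ, Set.range (surfaceVertex n d a h ∘ latticeTriangle (k, 2 * m) (-1)) =
      {vertexA n (k + m * (1 - d) - 1), vertexA n (k + m * (1 - d) - 1 + 1),
        vertexB n a h (k + m * (1 - d) - 1)} := by
    intro k m
    rw [range_comp_latticeTriangle]
    simp only [Units.val_neg, Units.val_one, surfaceVertex_even]
    rw [show 2 * m + -1 = 2 * (m - 1) + 1 by ring, surfaceVertex_odd,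
      show k + -1 + m * (1 - d) = k + m * (1 - d) - 1 by ring,
      show k - d + (m - 1) * (1 - d) = k + m * (1 - d) - 1 by ring, sub_add_cancel,
      Set.insert_comm]
  have h4 : ∀ k m : ℤ, Set.range (surfaceVertex n d a h ∘ latticeTriangle (k, 2 * m + 1) (-1)) =
      {vertexB n a h (k + m * (1 - d) - 1 - d), vertexA n (k + m * (1 - d) - 1 + 1),
        vertexB n a h (k + m * (1 - d) - 1 + 1 - d)} := by
    intro k m
    rw [range_comp_latticeTriangle]
    simp only [Units.val_neg, Units.val_one, surfaceVertex_odd]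
    rw [add_neg_cancel_right, surfaceVertex_even,
      show k + -1 - d + m * (1 - d) = k + m * (1 - d) - 1 - d by ring,
      show k - d + m * (1 - d) = k + m * (1 - d) - 1 + 1 - d by ring, sub_add_cancel,
      Set.insert_comm, Set.pair_comm]
  constructor
  · rintro ⟨k, rfl | rfl | rfl | rfl⟩
    · exact ⟨(k + 1, 2 * 0), -1, by rw [h3]; simp⟩
    · exact ⟨(k + d, 2 * 0 + 1), 1, by rw [h2]; simp⟩
    · exact ⟨(k, 2 * 0), 1, by rw [h1]; simp⟩
    · exact ⟨(k + 1, 2 * 0 + 1), -1, by rw [h4]; simp⟩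
  · rintro ⟨⟨k, j⟩, ε, rfl⟩
    rcases Int.even_or_odd' j with ⟨m, rfl | rfl⟩ <;> rcases Int.units_eq_one_or ε with rfl | rfl
    · exact ⟨_, Or.inr (Or.inr (Or.inl (h1 k m)))⟩
    · exact ⟨_, Or.inl (h3 k m)⟩
    · exact ⟨_, Or.inr (Or.inl (h2 k m))⟩
    · exact ⟨_, Or.inr (Or.inr (Or.inr (h4 k m)))⟩

end Surface

/-! ### Triangulations of the plane in straight rows. -/

/-- The origins of the rows of a developed diplotorus: `Q` is the offset of the first odd row and
`R` that of the following even row. -/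
def rowOrigin (Q R : ℂ) (j : ℤ) : ℂ := if Even j then (j / 2 : ℤ) * R else (j / 2 : ℤ) * R + Q

/-- The vertices of a developed diplotorus in the plane: in each row they have distance `s`. The
whole picture is scaled by the complex number `μ`. -/
def planeVertex (μ : ℂ) (s : ℝ) (Q R : ℂ) (v : ℤ × ℤ) : ℂ := μ * (v.1 * s + rowOrigin Q R v.2)

section Plane

variable {μ Q R : ℂ} {s : ℝ}

lemma rowOrigin_even (m : ℤ) : rowOrigin Q R (2 * m) = m * R := by
  simp [rowOrigin]

lemma rowOrigin_odd (m : ℤ) : rowOrigin Q R (2 * m + 1) = m * R + Q := by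
  have h1 : ¬ Even (2 * m + 1) := by simp
  have h2 : (2 * m + 1) / 2 = m := by omega
  simp only [rowOrigin, h1, if_false, h2]

lemma rowOrigin_succ_sub (j : ℤ) : rowOrigin Q R (j + 1) - rowOrigin Q R j = Q ∨
    rowOrigin Q R (j + 1) - rowOrigin Q R j = R - Q := by
  rcases Int.even_or_odd' j with ⟨m, rfl | rfl⟩
  · left
    rw [rowOrigin_even, rowOrigin_odd]
    ring
  · right
    rw [show 2 * m + 1 + 1 = 2 * (m + 1) by ring, rowOrigin_even, rowOrigin_odd]
    push_cast
    ring

lemma im_rowOrigin_lt (hQ : 0 < Q.im) (hR : Q.im < R.im) (j : ℤ) :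
    (rowOrigin Q R j).im < (rowOrigin Q R (j + 1)).im := by
  rw [← sub_pos, ← Complex.sub_im]
  rcases rowOrigin_succ_sub (Q := Q) (R := R) j with h | h <;> rw [h]
  · exact hQ
  · rw [Complex.sub_im]; linarith

/-- All rows have the same spacing, so the formulas for the two kinds of triangles coincide and the
map is affine on each strip. -/
lemma interp_planeVertex (p : ℝ × ℝ) : interp (planeVertex μ s Q R) p =
    μ * (p.1 * s + ((1 - Int.fract p.2 : ℝ) * rowOrigin Q R ⌊p.2⌋ +
      (Int.fract p.2 : ℝ) * rowOrigin Q R (⌊p.2⌋ + 1))) := by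
  have h : (p.1 : ℂ) = ⌊p.1⌋ + (Int.fract p.1 : ℝ) := by
    exact_mod_cast (Int.floor_add_fract p.1).symm
  rw [interp, h]
  split_ifs <;> simp only [planeVertex, Complex.real_smul] <;> push_cast <;> ring

lemma exists_im_rowOrigin_le (hQ : 0 < Q.im) (hR : Q.im < R.im) (y : ℝ) :
    ∃ j : ℤ, (rowOrigin Q R j).im ≤ y ∧ y < (rowOrigin Q R (j + 1)).im := by
  have hR0 : 0 < R.im := hQ.trans hR
  obtain ⟨m, hm⟩ : ∃ m, ⌊y / R.im⌋ = m := ⟨_, rfl⟩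
  obtain ⟨h1, h2⟩ := Int.floor_eq_iff.1 hm
  rw [le_div_iff₀ hR0] at h1
  rw [div_lt_iff₀ hR0] at h2
  by_cases h : y < m * R.im + Q.im
  · refine ⟨2 * m, ?_, ?_⟩
    · rw [rowOrigin_even]; simpa using h1
    · rw [rowOrigin_odd]; simpa using h
  · refine ⟨2 * m + 1, ?_, ?_⟩
    · rw [rowOrigin_odd]; simpa using h
    · rw [show 2 * m + 1 + 1 = 2 * (m + 1) by ring, rowOrigin_even]; simpa using h2

/-- Up to the factor μ the rows are horizontal lines at strictly increasing heights: the imaginary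
part determines the second coordinate, and the real part then determines the first. -/
lemma interp_planeVertex_bijective (hμ : μ ≠ 0) (hs : 0 < s) (hQ : 0 < Q.im) (hR : Q.im < R.im) :
    Function.Bijective (interp (planeVertex μ s Q R)) := by
  have hlt := im_rowOrigin_lt hQ hR
  have hmono : StrictMono fun j => (rowOrigin Q R j).im := strictMono_int_of_lt_succ hlt
  have hs' : (s : ℂ) ≠ 0 := by exact_mod_cast hs.ne'
  constructor
  · intro p q h
    rw [interp_planeVertex, interp_planeVertex] at h
    have h1 := mul_left_cancel₀ hμ h
    have him := congrArg Complex.im h1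
    simp only [Complex.add_im, Complex.im_ofReal_mul, Complex.ofReal_im, mul_zero, zero_add] at him
    have key : ∀ y y' : ℝ, y < y' →
        (1 - Int.fract y) * (rowOrigin Q R ⌊y⌋).im + Int.fract y * (rowOrigin Q R (⌊y⌋ + 1)).im <
        (1 - Int.fract y') * (rowOrigin Q R ⌊y'⌋).im +
          Int.fract y' * (rowOrigin Q R (⌊y'⌋ + 1)).im := by
      intro y y' hy
      have f0 := Int.fract_nonneg y'
      have f1 := Int.fract_lt_one y
      have l1 := hlt ⌊y⌋
      have l2 := hlt ⌊y'⌋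
      rcases eq_or_lt_of_le (Int.floor_mono hy.le) with e | e
      · have : Int.fract y < Int.fract y' := by
          rw [Int.fract, Int.fract, e]; linarith
        rw [e] at l1 ⊢
        nlinarith
      · have : (rowOrigin Q R (⌊y⌋ + 1)).im ≤ (rowOrigin Q R ⌊y'⌋).im :=
          hmono.monotone (show ⌊y⌋ + 1 ≤ ⌊y'⌋ by omega)
        nlinarith
    have h2 : p.2 = q.2 := by
      rcases lt_trichotomy p.2 q.2 with g | g | g
      · exact absurd him (key _ _ g).ne
      · exact g
      · exact absurd him (key _ _ g).ne'
    rw [h2] at h1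
    have h3 := mul_right_cancel₀ hs' (add_right_cancel h1)
    exact Prod.ext (by exact_mod_cast h3) h2
  · intro z
    obtain ⟨j, hj1, hj2⟩ := exists_im_rowOrigin_le hQ hR (z / μ).im
    set D : ℝ := (rowOrigin Q R (j + 1)).im - (rowOrigin Q R j).im with hD
    have hD0 : 0 < D := by linarith
    set β : ℝ := ((z / μ).im - (rowOrigin Q R j).im) / D with hβ
    have hβ0 : 0 ≤ β := div_nonneg (by linarith) hD0.le
    have hβ1 : β < 1 := by rw [hβ, div_lt_one hD0]; linarith
    obtain ⟨f1, f2⟩ := floor_fract_add (i := j) hβ0 hβ1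
    set u : ℂ := z / μ - ((1 - β : ℝ) * rowOrigin Q R j + (β : ℝ) * rowOrigin Q R (j + 1)) with hu
    have hu0 : u.im = 0 := by
      have : β * D = (z / μ).im - (rowOrigin Q R j).im := div_mul_cancel₀ _ hD0.ne'
      rw [hu, Complex.sub_im, Complex.add_im, Complex.im_ofReal_mul, Complex.im_ofReal_mul]
      rw [hD] at this
      linarith
    refine ⟨(u.re / s, j + β), ?_⟩
    rw [interp_planeVertex]
    simp only [f1, f2]
    have e : ((u.re / s : ℝ) : ℂ) * s = u := by
      rw [← Complex.ofReal_mul, div_mul_cancel₀ _ hs.ne']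
      apply Complex.ext <;> simp [hu0]
    rw [e, hu]
    field_simp
    ring

lemma finite_int_abs_le {b : ℝ} (hb : 0 < b) (c r : ℝ) : {k : ℤ | |k * b + c| ≤ r}.Finite := by
  refine (Set.finite_Icc ⌊(-r - c) / b⌋ ⌈(r - c) / b⌉).subset fun k hk => ?_
  obtain ⟨h1, h2⟩ := abs_le.1 (show |k * b + c| ≤ r from hk)
  constructor
  · have : ((-r - c) / b) ≤ k := by rw [div_le_iff₀ hb]; linarith
    exact_mod_cast (Int.floor_le _).trans this
  · have : (k : ℝ) ≤ (r - c) / b := by rw [le_div_iff₀ hb]; linarith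
    exact_mod_cast this.trans (Int.le_ceil _)

lemma finite_norm_planeVertex_le (hμ : μ ≠ 0) (hs : 0 < s) (hR : 0 < R.im) (r : ℝ) :
    {v | ‖planeVertex μ s Q R v‖ ≤ r}.Finite := by
  have hμ' : 0 < ‖μ‖ := norm_pos_iff.2 hμ
  let J : Set ℤ := {j | |(rowOrigin Q R j).im| ≤ r / ‖μ‖}
  have hJ : J.Finite := by
    refine (((finite_int_abs_le hR 0 (r / ‖μ‖)).image fun m => 2 * m).union
      ((finite_int_abs_le hR Q.im (r / ‖μ‖)).image fun m => 2 * m + 1)).subset fun j hj => ?_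
    change |(rowOrigin Q R j).im| ≤ _ at hj
    rcases Int.even_or_odd' j with ⟨m, rfl | rfl⟩
    · exact Or.inl ⟨m, by simpa [rowOrigin_even] using hj, rfl⟩
    · exact Or.inr ⟨m, by simpa [rowOrigin_odd] using hj, rfl⟩
  refine (hJ.biUnion fun j _ =>
    (finite_int_abs_le hs (rowOrigin Q R j).re (r / ‖μ‖)).image fun k => (k, j)).subset ?_
  rintro ⟨k, j⟩ hv
  have hv' : ‖(k * s + rowOrigin Q R j : ℂ)‖ ≤ r / ‖μ‖ := by
    rw [le_div_iff₀ hμ', mul_comm, ← norm_mul]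
    exact hv
  refine Set.mem_biUnion (show j ∈ J from ?_) ⟨k, ?_, rfl⟩
  · refine le_trans ?_ hv'
    have := Complex.abs_im_le_norm (k * s + rowOrigin Q R j : ℂ)
    simpa using this
  · refine le_trans ?_ hv'
    have := Complex.abs_re_le_norm (k * s + rowOrigin Q R j : ℂ)
    simpa using this

lemma norm_planeVertex_sub_le (hs : 0 < s) (v : ℤ × ℤ) (ε : ℤˣ) (i : Fin 3) :
    ‖planeVertex μ s Q R (latticeTriangle v ε i) - planeVertex μ s Q R v‖ ≤
      ‖μ‖ * (s + ‖Q‖ + ‖R - Q‖) := by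
  have hrow : ∀ j, ‖rowOrigin Q R (j + 1) - rowOrigin Q R j‖ ≤ s + ‖Q‖ + ‖R - Q‖ := by
    intro j
    have := norm_nonneg Q
    have := norm_nonneg (R - Q)
    rcases rowOrigin_succ_sub (Q := Q) (R := R) j with h | h <;> rw [h] <;> linarith
  have hs1 : ‖(s : ℂ)‖ ≤ s + ‖Q‖ + ‖R - Q‖ := by
    rw [Complex.norm_real, Real.norm_of_nonneg hs.le]
    have := norm_nonneg Q
    have := norm_nonneg (R - Q)
    linarith
  rw [planeVertex, planeVertex, ← mul_sub, norm_mul]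
  refine mul_le_mul_of_nonneg_left ?_ (norm_nonneg _)
  fin_cases i
  · simp only [latticeTriangle, Fin.zero_eta, Matrix.cons_val_zero, sub_self, norm_zero]
    exact (norm_nonneg _).trans hs1
  · rcases Int.units_eq_one_or ε with rfl | rfl
    · simpa [latticeTriangle, add_mul] using hs1
    · simpa [latticeTriangle, add_mul] using hs1
  · rcases Int.units_eq_one_or ε with rfl | rfl
    · simpa [latticeTriangle] using hrow v.2
    · have := hrow (v.2 - 1)
      rw [sub_add_cancel, norm_sub_rev] at this
      simpa [latticeTriangle, ← sub_eq_add_neg] using this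

/-- Up to the factor μ one side is horizontal and nonzero, while another joins rows of different
height. -/
lemma affineIndependent_planeVertex (hμ : μ ≠ 0) (hs : 0 < s) (hQ : 0 < Q.im) (hR : Q.im < R.im)
    (v : ℤ × ℤ) (ε : ℤˣ) :
    AffineIndependent ℝ (planeVertex μ s Q R ∘ latticeTriangle v ε) := by
  rw [affineIndependent_iff_not_collinear, range_comp_latticeTriangle,
    collinear_iff_of_mem (Set.mem_insert _ _)]
  rintro ⟨w, hw⟩
  obtain ⟨r, hr⟩ := hw (planeVertex μ s Q R (v.1 + ε, v.2)) (by simp)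
  obtain ⟨r', hr'⟩ := hw (planeVertex μ s Q R (v.1, v.2 + ε)) (by simp)
  simp only [planeVertex, vadd_eq_add, Complex.real_smul] at hr hr'
  have h1 : r * (w / μ) = (ε : ℤ) * s := by
    field_simp
    push_cast at hr
    linear_combination -hr
  have h2 : r' * (w / μ) = rowOrigin Q R (v.2 + ε) - rowOrigin Q R v.2 := by
    field_simp
    linear_combination -hr'
  have h3 : ((rowOrigin Q R (v.2 + ε) - rowOrigin Q R v.2).im) ≠ 0 := by
    have hlt := im_rowOrigin_lt hQ hR
    rw [Complex.sub_im, sub_ne_zero]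
    rcases Int.units_eq_one_or ε with rfl | rfl
    · exact (hlt v.2).ne'
    · have := hlt (v.2 - 1)
      rw [sub_add_cancel] at this
      exact this.ne
  rw [← h2, Complex.im_ofReal_mul] at h3
  have h4 := congrArg Complex.im h1
  have h5 := congrArg Complex.re h1
  rw [Complex.im_ofReal_mul] at h4
  rw [Complex.re_ofReal_mul] at h5
  have h6 : r = 0 := by
    rcases mul_eq_zero.1 (h4.trans (by simp)) with h | h
    · exact h
    · exact absurd (by rw [h, mul_zero]) h3
  rw [h6, zero_mul] at h5
  rcases Int.units_eq_one_or ε with rfl | rfl <;> simp at h5 <;> exact hs.ne' (by linarith)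

end Plane

/-! ### Edge lengths of the diplotorus. -/

section Lengths

variable {n d : ℤ} {a h : ℝ}

/-- Height of a strip of a developed ploid. -/
def stripHeight (n : ℤ) (h y : ℝ) : ℝ :=
  √(h ^ 2 + (Real.cos (Real.pi / n) - Real.cos (y * (Real.pi / n))) ^ 2)

lemma stripHeight_pos (hh : 0 < h) (y : ℝ) : 0 < stripHeight n h y :=
  Real.sqrt_pos.2 (by positivity)

lemma sq_stripHeight (y : ℝ) : stripHeight n h y ^ 2 =
    h ^ 2 + (Real.cos (Real.pi / n) - Real.cos (y * (Real.pi / n))) ^ 2 :=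
  Real.sq_sqrt (by positivity)

/-- This rewrites the radicands of the modulus as squared altitudes: cos x is the apothem of the
polygon and cos (y x) the coordinate of the opposite vertex along it. -/
lemma sin_sq_mul_sin_sq (y x : ℝ) : 4 * Real.sin ((y + 1) / 2 * x) ^ 2 *
    Real.sin ((y - 1) / 2 * x) ^ 2 = (Real.cos x - Real.cos (y * x)) ^ 2 := by
  have h := Real.cos_sub_cos x (y * x)
  rw [show (x + y * x) / 2 = (y + 1) / 2 * x by ring,
    show (x - y * x) / 2 = -((y - 1) / 2 * x) by ring, Real.sin_neg] at h
  rw [h]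
  ring

lemma modulusIm_eq : modulusIm n d a h =
    (stripHeight n h a + stripHeight n h (a - 2 * d)) / (2 * n * Real.sin (Real.pi / n)) := by
  rw [modulusIm, stripHeight, stripHeight, sin_sq_mul_sin_sq a, sin_sq_mul_sin_sq (a - 2 * d)]

lemma dist_vertexA_vertexA (hn : 4 < n) (k : ℤ) :
    dist (vertexA n (k + 1)) (vertexA n k) = 2 * Real.sin (Real.pi / n) := by
  have hn' : (5 : ℝ) ≤ n := by exact_mod_cast hn
  have hsin : 0 ≤ Real.sin (Real.pi / n) := by
    have := sin_pi_mul_nonneg hn zero_le_one (by linarith)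
    rwa [mul_one] at this
  rw [← sq_eq_sq₀ dist_nonneg (by positivity), EuclideanSpace.dist_eq, Real.sq_sqrt (by positivity),
    Fin.sum_univ_three]
  simp only [vertexA, Real.dist_eq, sq_abs]
  rw [show 2 * Real.pi * ((k + 1 : ℤ) : ℝ) / n = 2 * Real.pi * k / n + 2 * (Real.pi / n) by
    push_cast; ring]
  simp [Real.cos_add, Real.sin_add, Real.cos_two_mul, Real.sin_two_mul]
  have h1 := Real.sin_sq_add_cos_sq (2 * Real.pi * k / n)
  have h2 := Real.sin_sq_add_cos_sq (Real.pi / n)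
  set C := Real.cos (2 * Real.pi * k / n)
  set S := Real.sin (2 * Real.pi * k / n)
  set c := Real.cos (Real.pi / n)
  set σ := Real.sin (Real.pi / n)
  have h3 : c ^ 2 = 1 - σ ^ 2 := by linarith
  have h4 : C ^ 2 = 1 - S ^ 2 := by linarith
  rw [h3]
  ring_nf
  simp only [h3, h4]
  ring

lemma sq_dist_vertexA_vertexB (k l : ℤ) : dist (vertexA n k) (vertexB n a h l) ^ 2 =
    2 - 2 * Real.cos ((a + 1 + 2 * (l - k)) * (Real.pi / n)) + h ^ 2 := by
  rw [EuclideanSpace.dist_eq, Real.sq_sqrt (by positivity), Fin.sum_univ_three]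
  simp only [vertexA, vertexB, Real.dist_eq, sq_abs]
  rw [show (a + 1 + 2 * ((l : ℝ) - k)) * (Real.pi / n) =
    Real.pi / n * (a + 1 + 2 * l) - 2 * Real.pi * k / n by ring, Real.cos_sub]
  simp
  have h1 := Real.sin_sq_add_cos_sq (2 * Real.pi * k / n)
  have h2 := Real.sin_sq_add_cos_sq (Real.pi / n * (a + 1 + 2 * l))
  linear_combination h1 + h2

lemma dist_vertexB_vertexB (hn : 4 < n) (k : ℤ) :
    dist (vertexB n a h (k + 1)) (vertexB n a h k) = 2 * Real.sin (Real.pi / n) := by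
  rw [← dist_vertexA_vertexA hn 0, ← sq_eq_sq₀ dist_nonneg dist_nonneg, EuclideanSpace.dist_eq,
    EuclideanSpace.dist_eq, Real.sq_sqrt (by positivity), Real.sq_sqrt (by positivity),
    Fin.sum_univ_three, Fin.sum_univ_three]
  simp only [vertexA, vertexB, Real.dist_eq, sq_abs]
  rw [show Real.pi / n * (a + 1 + 2 * ((k + 1 : ℤ) : ℝ)) =
      Real.pi / n * (a + 1 + 2 * k) + 2 * (Real.pi / n) by push_cast; ring,
    show 2 * Real.pi * ((0 + 1 : ℤ) : ℝ) / n = 2 * (Real.pi / n) by push_cast; ring]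
  simp [Real.cos_add, Real.sin_add]
  have h1 := Real.sin_sq_add_cos_sq (Real.pi / n * (a + 1 + 2 * k))
  have h2 := Real.sin_sq_add_cos_sq (2 * (Real.pi / n))
  set C := Real.cos (Real.pi / n * (a + 1 + 2 * k))
  set S := Real.sin (Real.pi / n * (a + 1 + 2 * k))
  set c := Real.cos (2 * (Real.pi / n))
  set σ := Real.sin (2 * (Real.pi / n))
  linear_combination ((c - 1) ^ 2 + σ ^ 2) * h1

/-- The offset of the row of vertices `B` in the development of the external ploid. -/
def offsetExt (n d : ℤ) (a h : ℝ) : ℂ :=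
  ⟨Real.sin (Real.pi / n) + Real.sin ((a - 2 * d) * (Real.pi / n)), stripHeight n h (a - 2 * d)⟩

/-- The offset of the row of vertices `A` in the development of the internal ploid. -/
def offsetInt (n : ℤ) (a h : ℝ) : ℂ :=
  ⟨Real.sin (Real.pi / n) - Real.sin (a * (Real.pi / n)), stripHeight n h a⟩

lemma sq_norm_eq (z : ℂ) : ‖z‖ ^ 2 = z.re ^ 2 + z.im ^ 2 := by
  rw [Complex.sq_norm, Complex.normSq_apply]
  ring

lemma sin_add_sin_sq (x y : ℝ) : (Real.sin x + Real.sin y) ^ 2 + (Real.cos x - Real.cos y) ^ 2 =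
    2 - 2 * Real.cos (y + x) := by
  rw [Real.cos_add]
  linear_combination Real.sin_sq_add_cos_sq x + Real.sin_sq_add_cos_sq y

lemma sin_sub_sin_sq (x y : ℝ) : (Real.sin x - Real.sin y) ^ 2 + (Real.cos x - Real.cos y) ^ 2 =
    2 - 2 * Real.cos (y - x) := by
  rw [Real.cos_sub]
  linear_combination Real.sin_sq_add_cos_sq x + Real.sin_sq_add_cos_sq y

/-- Seen from the midpoint of the edge `A_k A_{k+1}`, the vertex `B_{k-d}` is displaced by sin((a -
2d)π/n) along the edge, and `stripHeight` is its distance from the line of the edge. The internal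
ploid is the same with a in place of a - 2d. -/
lemma norm_offsetExt (k : ℤ) :
    ‖offsetExt n d a h‖ = dist (vertexA n k) (vertexB n a h (k - d)) := by
  rw [← sq_eq_sq₀ (norm_nonneg _) dist_nonneg, sq_norm_eq, sq_dist_vertexA_vertexB, offsetExt]
  simp only [sq_stripHeight]
  have := sin_add_sin_sq (Real.pi / n) ((a - 2 * d) * (Real.pi / n))
  rw [show (a + 1 + 2 * (((k - d : ℤ) : ℝ) - k)) * (Real.pi / n) =
    (a - 2 * d) * (Real.pi / n) + Real.pi / n by push_cast; ring]
  linear_combination this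

lemma norm_sub_offsetExt (k : ℤ) : ‖((2 * Real.sin (Real.pi / n) : ℝ) : ℂ) - offsetExt n d a h‖ =
    dist (vertexA n (k + 1)) (vertexB n a h (k - d)) := by
  rw [← sq_eq_sq₀ (norm_nonneg _) dist_nonneg, sq_norm_eq, sq_dist_vertexA_vertexB, offsetExt]
  simp only [Complex.sub_re, Complex.sub_im, Complex.ofReal_re, Complex.ofReal_im, zero_sub, neg_sq,
    sq_stripHeight]
  have := sin_sub_sin_sq (Real.pi / n) ((a - 2 * d) * (Real.pi / n))
  rw [show (a + 1 + 2 * (((k - d : ℤ) : ℝ) - ((k + 1 : ℤ) : ℝ))) * (Real.pi / n) =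
    (a - 2 * d) * (Real.pi / n) - Real.pi / n by push_cast; ring]
  linear_combination this

lemma norm_offsetInt (k : ℤ) :
    ‖offsetInt n a h‖ = dist (vertexA n (k + 1)) (vertexB n a h k) := by
  rw [← sq_eq_sq₀ (norm_nonneg _) dist_nonneg, sq_norm_eq, sq_dist_vertexA_vertexB, offsetInt]
  simp only [sq_stripHeight]
  have := sin_sub_sin_sq (Real.pi / n) (a * (Real.pi / n))
  rw [show (a + 1 + 2 * ((k : ℝ) - ((k + 1 : ℤ) : ℝ))) * (Real.pi / n) =
    a * (Real.pi / n) - Real.pi / n by push_cast; ring]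
  linear_combination this

lemma norm_sub_offsetInt (k : ℤ) : ‖((2 * Real.sin (Real.pi / n) : ℝ) : ℂ) - offsetInt n a h‖ =
    dist (vertexA n k) (vertexB n a h k) := by
  rw [← sq_eq_sq₀ (norm_nonneg _) dist_nonneg, sq_norm_eq, sq_dist_vertexA_vertexB, offsetInt]
  simp only [Complex.sub_re, Complex.sub_im, Complex.ofReal_re, Complex.ofReal_im, zero_sub, neg_sq,
    sq_stripHeight]
  have := sin_add_sin_sq (Real.pi / n) (a * (Real.pi / n))
  rw [show (a + 1 + 2 * ((k : ℝ) - k)) * (Real.pi / n) =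
    a * (Real.pi / n) + Real.pi / n by ring]
  linear_combination this

end Lengths

/-! ### The developed diplotorus and its periods. -/

section Development

variable {n d : ℤ} {a h : ℝ} {μ : ℂ}

/-- The vertices of the developed diplotorus, scaled by `μ`. -/
abbrev developedVertex (n d : ℤ) (a h : ℝ) (μ : ℂ) : ℤ × ℤ → ℂ :=
  planeVertex μ (2 * Real.sin (Real.pi / n)) (offsetExt n d a h)
    (offsetExt n d a h + offsetInt n a h)

lemma sin_pi_div_pos (hn : 4 < n) : 0 < Real.sin (Real.pi / n) := by
  have hn' : (5 : ℝ) ≤ n := by exact_mod_cast hn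
  have := sin_pi_mul_pos hn one_pos (by linarith)
  rwa [mul_one] at this

lemma dist_developedVertex_right (hn : 4 < n) (k j : ℤ) :
    dist (developedVertex n d a h μ (k + 1, j)) (developedVertex n d a h μ (k, j)) =
      ‖μ‖ * dist (surfaceVertex n d a h (k + 1, j)) (surfaceVertex n d a h (k, j)) := by
  have hs := sin_pi_div_pos hn
  have e : dist (surfaceVertex n d a h (k + 1, j)) (surfaceVertex n d a h (k, j)) =
      2 * Real.sin (Real.pi / n) := by
    rcases Int.even_or_odd' j with ⟨m, rfl | rfl⟩
    · rw [surfaceVertex_even, surfaceVertex_even,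
        show k + 1 + m * (1 - d) = k + m * (1 - d) + 1 by ring, dist_vertexA_vertexA hn]
    · rw [surfaceVertex_odd, surfaceVertex_odd,
        show k + 1 - d + m * (1 - d) = k - d + m * (1 - d) + 1 by ring, dist_vertexB_vertexB hn]
  simp only [developedVertex, planeVertex]
  rw [e, dist_eq_norm, ← mul_sub, norm_mul]
  congr 1
  rw [show ∀ s r : ℂ, ((k + 1 : ℤ) : ℂ) * s + r - (k * s + r) = s by intro s r; push_cast; ring,
    Complex.norm_real, Real.norm_of_nonneg (by positivity)]

lemma dist_developedVertex_up (k j : ℤ) :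
    dist (developedVertex n d a h μ (k, j)) (developedVertex n d a h μ (k, j + 1)) =
      ‖μ‖ * dist (surfaceVertex n d a h (k, j)) (surfaceVertex n d a h (k, j + 1)) := by
  simp only [developedVertex, planeVertex]
  rw [dist_comm, dist_eq_norm, ← mul_sub, norm_mul,
    add_sub_add_left_eq_sub]
  congr 1
  rcases Int.even_or_odd' j with ⟨m, rfl | rfl⟩
  · rw [rowOrigin_even, rowOrigin_odd, add_sub_cancel_left, surfaceVertex_even, surfaceVertex_odd,
      show k - d + m * (1 - d) = k + m * (1 - d) - d by ring, norm_offsetExt]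
  · rw [show 2 * m + 1 + 1 = 2 * (m + 1) by ring, rowOrigin_even, rowOrigin_odd,
      surfaceVertex_even, surfaceVertex_odd,
      show k + (m + 1) * (1 - d) = k - d + m * (1 - d) + 1 by ring, dist_comm, ← norm_offsetInt]
    congr 1
    push_cast
    ring

lemma dist_developedVertex_diag (k j : ℤ) :
    dist (developedVertex n d a h μ (k + 1, j)) (developedVertex n d a h μ (k, j + 1)) =
      ‖μ‖ * dist (surfaceVertex n d a h (k + 1, j)) (surfaceVertex n d a h (k, j + 1)) := by
  simp only [developedVertex, planeVertex]
  rw [dist_eq_norm, ← mul_sub, norm_mul]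
  congr 1
  rcases Int.even_or_odd' j with ⟨m, rfl | rfl⟩
  · rw [rowOrigin_even, rowOrigin_odd, surfaceVertex_even, surfaceVertex_odd,
      show k - d + m * (1 - d) = k + m * (1 - d) - d by ring,
      show k + 1 + m * (1 - d) = k + m * (1 - d) + 1 by ring, ← norm_sub_offsetExt]
    congr 1
    push_cast
    ring
  · rw [show 2 * m + 1 + 1 = 2 * (m + 1) by ring, rowOrigin_even, rowOrigin_odd,
      surfaceVertex_even, surfaceVertex_odd,
      show k + (m + 1) * (1 - d) = k - d + m * (1 - d) + 1 by ring,
      show k + 1 - d + m * (1 - d) = k - d + m * (1 - d) + 1 by ring, dist_comm,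
      ← norm_sub_offsetInt]
    congr 1
    push_cast
    ring

/-- The triangles of a diplotorus are similar to those of its development. -/
lemma dist_developedVertex (hn : 4 < n) (v : ℤ × ℤ) (ε : ℤˣ) (i j : Fin 3) :
    dist (developedVertex n d a h μ (latticeTriangle v ε i))
        (developedVertex n d a h μ (latticeTriangle v ε j)) =
      ‖μ‖ * dist (surfaceVertex n d a h (latticeTriangle v ε i))
        (surfaceVertex n d a h (latticeTriangle v ε j)) := by
  obtain ⟨k, l⟩ := v
  wlog hij : i < j generalizing i j
  · rcases eq_or_lt_of_le (not_lt.1 hij) with rfl | hji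
    · simp
    · rw [dist_comm, this j i hji, dist_comm]
  rcases Int.units_eq_one_or ε with rfl | rfl
  · fin_cases i <;> fin_cases j <;> simp [latticeTriangle] at hij ⊢
    · rw [dist_comm, dist_developedVertex_right hn, dist_comm]
    · exact dist_developedVertex_up k l
    · exact dist_developedVertex_diag k l
  -- The sides of a downward triangle are sides of upward triangles at neighbouring corners.
  · have e1 : k = k - 1 + 1 := by ring
    have e2 : l = l - 1 + 1 := by ring
    fin_cases i <;> fin_cases j <;> simp [latticeTriangle, ← sub_eq_add_neg] at hij ⊢
    · have := dist_developedVertex_right (d := d) (a := a) (h := h) (μ := μ) hn (k - 1) l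
      rwa [← e1] at this
    · have := dist_developedVertex_up (n := n) (d := d) (a := a) (h := h) (μ := μ) k (l - 1)
      rw [← e2] at this
      rw [dist_comm, this, dist_comm]
    · have := dist_developedVertex_diag (n := n) (d := d) (a := a) (h := h) (μ := μ) (k - 1) (l - 1)
      rw [← e1, ← e2] at this
      rw [dist_comm, this, dist_comm]

/-- The second period of the development. -/
lemma offset_period (hn : 4 < n) {z : ℂ} (hre : z.re = modulusRe n d a)
    (him : z.im = modulusIm n d a h) :
    ((d : ℂ) - 1) * (2 * Real.sin (Real.pi / n) : ℝ) + (offsetExt n d a h + offsetInt n a h) =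
      n * (2 * Real.sin (Real.pi / n) : ℝ) * z := by
  have hs := (sin_pi_div_pos hn).ne'
  have hn' : (n : ℝ) ≠ 0 := by exact_mod_cast (show n ≠ 0 by omega)
  have e : (n : ℂ) * (2 * Real.sin (Real.pi / n) : ℝ) * z =
    ((n * (2 * Real.sin (Real.pi / n)) : ℝ) : ℂ) * z := by push_cast; ring
  have e' : ((d : ℂ) - 1) * (2 * Real.sin (Real.pi / n) : ℝ) =
    (((d - 1) * (2 * Real.sin (Real.pi / n)) : ℝ) : ℂ) := by push_cast; ring
  rw [e, e']
  apply Complex.ext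
  · rw [Complex.re_ofReal_mul, hre, modulusRe]
    simp only [Complex.add_re, Complex.ofReal_re, offsetExt, offsetInt]
    -- The difference of the two horizontal offsets becomes the product in the closed formula of the
    -- real part.
    have h1 := Real.sin_sub_sin (a * (Real.pi / n)) ((a - 2 * d) * (Real.pi / n))
    rw [show (a * (Real.pi / n) - (a - 2 * d) * (Real.pi / n)) / 2 = d * (Real.pi / n) by ring,
      show (a * (Real.pi / n) + (a - 2 * d) * (Real.pi / n)) / 2 = (a - d) * (Real.pi / n) by ring]
      at h1
    generalize Real.pi / n = x at hs h1 ⊢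
    generalize Real.sin (a * x) = A at h1 ⊢
    generalize Real.sin ((a - 2 * d) * x) = B at h1 ⊢
    generalize Real.cos ((a - d) * x) = C at h1 ⊢
    generalize Real.sin (d * x) = D at h1 ⊢
    field_simp
    linear_combination -h1
  · rw [Complex.im_ofReal_mul, him, modulusIm_eq]
    simp only [Complex.add_im, Complex.ofReal_im, offsetExt, offsetInt]
    field_simp
    ring

/-- Deck transformations act on the development by translations; μ is normalized so that the first
period is κ and the period ratio is z. -/
lemma developedVertex_add (hn : 4 < n) {z κ : ℂ} (hre : z.re = modulusRe n d a)
    (him : z.im = modulusIm n d a h)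
    (hμ : μ * (n * (2 * Real.sin (Real.pi / n) : ℝ)) = κ) (p m : ℤ) (v : ℤ × ℤ) :
    developedVertex n d a h μ (v + (p * n + m * (d - 1), 2 * m)) =
      developedVertex n d a h μ v + κ * (p + m * z) := by
  have hper := offset_period hn hre him
  have hrow : ∀ Q R : ℂ, rowOrigin Q R (v.2 + 2 * m) = rowOrigin Q R v.2 + m * R := by
    intro Q R
    rcases Int.even_or_odd' v.2 with ⟨l, e | e⟩ <;> rw [e]
    · rw [← mul_add, rowOrigin_even, rowOrigin_even]; push_cast; ring
    · rw [show 2 * l + 1 + 2 * m = 2 * (l + m) + 1 by ring, rowOrigin_odd, rowOrigin_odd]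
      push_cast; ring
  simp only [developedVertex, planeVertex]
  rw [Prod.fst_add, Prod.snd_add, hrow, ← hμ]
  push_cast at hper ⊢
  linear_combination μ * m * hper

/-- κ is the denominator g₁₀ τ + g₁₁, and the unimodular matrix g changes the basis of the lattice.
-/
lemma mem_lattice_iff_smul {τ : ℍ} (g : SL(2, ℤ)) : ∃ κ : ℂ, κ ≠ 0 ∧
    ∀ l : ℂ, l ∈ lattice τ ↔ ∃ p m : ℤ, l = κ * (p + m * ((g • τ : ℍ) : ℂ)) := by
  have hdet := g.det_coe
  rw [Matrix.det_fin_two] at hdet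
  have hdet' : (g 0 0 : ℂ) * g 1 1 - g 0 1 * g 1 0 = 1 := by exact_mod_cast hdet
  have hκ : (g 1 0 : ℂ) * (τ : ℂ) + g 1 1 ≠ 0 := by
    have := UpperHalfPlane.denom_ne_zero (g : GL (Fin 2) ℝ) τ
    simpa [UpperHalfPlane.denom] using this
  have hnum : ((g 1 0 : ℂ) * (τ : ℂ) + g 1 1) * ((g • τ : ℍ) : ℂ) = g 0 0 * (τ : ℂ) + g 0 1 := by
    rw [UpperHalfPlane.coe_specialLinearGroup_apply]
    simp only [algebraMap_int_eq, eq_intCast, Complex.ofReal_intCast]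
    field_simp
  refine ⟨_, hκ, fun l => ?_⟩
  rw [mem_lattice_iff]
  constructor
  · rintro ⟨m, k, rfl⟩
    refine ⟨g 0 0 * k - g 0 1 * m, g 1 1 * m - g 1 0 * k, ?_⟩
    push_cast
    linear_combination (-(g 1 1 * m - g 1 0 * k) : ℂ) * hnum - (k + m * (τ : ℂ)) * hdet'
  · rintro ⟨p, m, rfl⟩
    refine ⟨g 1 0 * p + g 0 0 * m, g 1 1 * p + g 0 1 * m, ?_⟩
    push_cast
    linear_combination (m : ℂ) * hnum

/-- A flat torus whose modulus agrees with the one of a diplotorus up to the action of the modular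
group is realized by this diplotorus. -/
theorem isRealizedBy_diplotorus {τ : ℍ} (hd : 0 < d) (hadm : Admissible n d a h) (g : SL(2, ℤ))
    (hre : (g • τ).re = modulusRe n d a) (him : (g • τ).im = modulusIm n d a h) :
    IsRealizedBy τ (diplotorus n d a h) := by
  obtain ⟨hh, hn, hd2, hdn, hpos, -⟩ := hadm
  rw [abs_of_pos hd] at hd2 hdn
  obtain ⟨hda, han⟩ := hpos hd
  have hs := sin_pi_div_pos hn
  have hs2 : 0 < 2 * Real.sin (Real.pi / n) := by positivity
  obtain ⟨κ, hκ, hlat⟩ := mem_lattice_iff_smul (τ := τ) g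
  have hn0 : (n : ℂ) * (2 * Real.sin (Real.pi / n) : ℝ) ≠ 0 := by
    refine mul_ne_zero (by exact_mod_cast (show n ≠ 0 by omega)) ?_
    exact_mod_cast hs2.ne'
  set μ : ℂ := κ / (n * (2 * Real.sin (Real.pi / n) : ℝ)) with hμdef
  have hμ : μ ≠ 0 := div_ne_zero hκ hn0
  have hμ' : 0 < ‖μ‖ := norm_pos_iff.2 hμ
  have hμκ : μ * (n * (2 * Real.sin (Real.pi / n) : ℝ)) = κ := div_mul_cancel₀ _ hn0
  have hQ : 0 < (offsetExt n d a h).im := stripHeight_pos hh _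
  have hR : (offsetExt n d a h).im < (offsetExt n d a h + offsetInt n a h).im := by
    rw [Complex.add_im]
    exact lt_add_of_pos_right _ (stripHeight_pos hh _)
  have hadd := developedVertex_add (μ := μ) (κ := κ) hn hre him hμκ
  refine isRealizedBy_of_periodic (V := surfaceVertex n d a h) (W := developedVertex n d a h μ)
    (c := ‖μ‖⁻¹) (Γ := deckGroup n d) (inv_pos.2 hμ') (interp_planeVertex_bijective hμ hs2 hQ hR)
    (finite_norm_planeVertex_le hμ hs2 (hQ.trans hR)) (norm_planeVertex_sub_le hs2)
    (affineIndependent_planeVertex hμ hs2 hQ hR) (fun v ε i j => ?_)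
    (fun γ hγ v => surfaceVertex_add hn hγ v)
    (interp_surfaceVertex_injective hn hd2 hdn hda han hh) ?_ ?_
    (mem_diplotorus_iff_exists_latticeTriangle hn) finite_diplotorus
  · rw [dist_developedVertex hn, inv_mul_cancel_left₀ hμ'.ne']
  · intro γ hγ
    obtain ⟨p, m, rfl⟩ := mem_deckGroup_iff.1 hγ
    exact ⟨_, (hlat _).2 ⟨p, m, rfl⟩, hadd p m⟩
  · intro l hl
    obtain ⟨p, m, rfl⟩ := (hlat l).1 hl
    exact ⟨_, mem_deckGroup_iff.2 ⟨p, m, rfl⟩, hadd p m⟩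

end Development

/-! ### The moduli attained for fixed n and d. -/

section Parameters

lemma continuous_stripHeight (n : ℤ) (y : ℝ) : Continuous fun h => stripHeight n h y := by
  unfold stripHeight
  fun_prop

lemma stripHeight_zero (n : ℤ) (y : ℝ) :
    stripHeight n 0 y = |Real.cos (Real.pi / n) - Real.cos (y * (Real.pi / n))| := by
  rw [stripHeight, zero_pow two_ne_zero, zero_add, Real.sqrt_sq_eq_abs]

lemma le_stripHeight (n : ℤ) (h y : ℝ) : h ≤ stripHeight n h y := by
  refine Real.le_sqrt_of_sq_le ?_
  linarith [sq_nonneg (Real.cos (Real.pi / n) - Real.cos (y * (Real.pi / n)))]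

/-- The imaginary part of the modulus takes every value above its limit for `h = 0`. -/
lemma exists_modulusIm_eq {n d : ℤ} {a y : ℝ} (hn : 4 < n) (hy : modulusIm n d a 0 < y) :
    ∃ h, 0 < h ∧ modulusIm n d a h = y := by
  have hs := sin_pi_div_pos hn
  have hn' : (5 : ℝ) ≤ n := by exact_mod_cast hn
  have hpos : 0 < 2 * n * Real.sin (Real.pi / n) := by positivity
  have hy0 : 0 < y := by
    refine lt_of_le_of_lt ?_ hy
    rw [modulusIm_eq]
    exact div_nonneg (add_nonneg (Real.sqrt_nonneg _) (Real.sqrt_nonneg _)) hpos.le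
  -- Each strip height is at least h, so at h = H the imaginary part already exceeds y.
  set H := y * (2 * n * Real.sin (Real.pi / n)) with hH
  have hH0 : 0 < H := by positivity
  have hcont : Continuous fun h => modulusIm n d a h := by
    simp only [modulusIm_eq]
    exact ((continuous_stripHeight n _).add (continuous_stripHeight n _)).div_const _
  have hle : y ≤ modulusIm n d a H := by
    rw [modulusIm_eq, le_div_iff₀ hpos]
    linarith [le_stripHeight n H a, le_stripHeight n H (a - 2 * d)]
  obtain ⟨h, ⟨h0, -⟩, hh⟩ := intermediate_value_Icc hH0.le hcont.continuousOn ⟨hy.le, hle⟩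
  refine ⟨h, lt_of_le_of_ne h0 ?_, hh⟩
  rintro rfl
  exact hy.ne hh

/-- Every point above two explicit curves is the modulus of a diplotorus. -/
lemma exists_parameters {n d : ℤ} {X Y C : ℝ} (hn : 4 < n) (hd : 2 ≤ d) (hdn : d < n - 2)
    (hC : C = Real.sin (d * (Real.pi / n)) / (n * Real.sin (Real.pi / n))) (hY : 0 < Y)
    (hX1 : d / n - X < C * Real.cos (Real.pi / n))
    (hX2 : C * Real.cos ((n - 1 - d) * (Real.pi / n)) < d / n - X)
    (hlin : Real.cos (Real.pi / n) / (n * Real.sin (Real.pi / n)) -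
      (d / n - X) * (Real.cos (d * (Real.pi / n)) / Real.sin (d * (Real.pi / n))) < Y)
    (harc : C ^ 2 - (d / n - X) ^ 2 < Y ^ 2) :
    ∃ a h : ℝ, Admissible n d a h ∧ X = modulusRe n d a ∧ Y = modulusIm n d a h := by
  have hs := sin_pi_div_pos hn
  have hn' : (5 : ℝ) ≤ n := by exact_mod_cast hn
  have hd' : (2 : ℝ) ≤ d := by exact_mod_cast hd
  have hdn' : (d : ℝ) + 3 ≤ n := by exact_mod_cast (show d + 3 ≤ n by omega)
  have hn0 : (n : ℝ) ≠ 0 := by linarith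
  set x := Real.pi / n with hx
  have hnx : n * x = Real.pi := by rw [hx]; field_simp
  have hx0 : 0 < x := by have := Real.pi_pos; positivity
  have hdx : 0 < Real.sin (d * x) :=
    Real.sin_pos_of_pos_of_lt_pi (by positivity) (by rw [← hnx]; nlinarith)
  have hC0 : 0 < C := by rw [hC]; positivity
  -- The equation for the real part reads cos φ = u with φ = (a - d)π/n, and d + 1 < a < n - 1
  -- becomes π/n < φ < (n - 1 - d)π/n.
  set u := (d / n - X) / C with hu
  have huC : u * C = d / n - X := div_mul_cancel₀ _ hC0.ne'
  have hu1 : u < Real.cos x := by rw [hu, div_lt_iff₀ hC0]; linarith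
  have hu2 : Real.cos ((n - 1 - d) * x) < u := by rw [hu, lt_div_iff₀ hC0]; linarith
  have hcosφ : Real.cos (Real.arccos u) = u :=
    Real.cos_arccos (by linarith [Real.neg_one_le_cos ((n - 1 - d) * x)])
      (by linarith [Real.cos_le_one x])
  set φ := Real.arccos u with hφ
  have hφ0 : 0 ≤ φ := Real.arccos_nonneg u
  have hφπ : φ ≤ Real.pi := Real.arccos_le_pi u
  have hxφ : x < φ := by
    by_contra hle
    have := Real.cos_le_cos_of_nonneg_of_le_pi hφ0 (by rw [← hnx]; nlinarith) (not_lt.1 hle)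
    linarith
  have hφx : φ < (n - 1 - d) * x := by
    by_contra hle
    have := Real.cos_le_cos_of_nonneg_of_le_pi (by nlinarith) hφπ (not_lt.1 hle)
    linarith
  set a := d + φ / x with ha
  have hax : a * x = d * x + φ := by rw [ha, add_mul, div_mul_cancel₀ _ hx0.ne']
  have had : (a - d) * x = φ := by rw [sub_mul, hax]; ring
  have hbx : (a - 2 * d) * x = φ - d * x := by rw [sub_mul, hax]; ring
  have hre : X = modulusRe n d a := by
    rw [modulusRe, ← hx, had, hcosφ, mul_div_assoc, ← hC, huC]
    ring
  have hcosa : Real.cos (a * x) ≤ Real.cos x := by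
    refine Real.cos_le_cos_of_nonneg_of_le_pi hx0.le ?_ ?_ <;> rw [hax]
    · rw [← hnx]; nlinarith
    · nlinarith
  have h0 : modulusIm n d a 0 < Y := by
    rw [modulusIm_eq, stripHeight_zero, stripHeight_zero, ← hx, abs_of_nonneg (by linarith)]
    -- At h = 0 the strip heights are absolute values. One sign of the second gives a line in (X,
    -- Y), the other the arc Y = C sin φ of the circle of radius C about d/n.
    rcases le_total 0 (Real.cos x - Real.cos ((a - 2 * d) * x)) with hb | hb
    · refine lt_of_eq_of_lt ?_ hlin
      rw [abs_of_nonneg hb, hax, hbx, Real.cos_add, Real.cos_sub, hcosφ, ← huC, hC]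
      field_simp
      ring
    · refine lt_of_eq_of_lt (b := C * Real.sin φ) ?_ ?_
      · rw [abs_of_nonpos hb, hax, hbx, Real.cos_add, Real.cos_sub, hC]
        field_simp
        ring
      · refine lt_of_pow_lt_pow_left₀ 2 hY.le (lt_of_eq_of_lt ?_ harc)
        rw [mul_pow, Real.sin_sq, hcosφ, ← huC]
        ring
  obtain ⟨h, hh, him⟩ := exists_modulusIm_eq hn h0
  refine ⟨a, h, ⟨hh, hn, ?_, ?_, fun _ => ⟨?_, ?_⟩, fun hneg => by omega⟩, hre, him.symm⟩
  · rwa [abs_of_pos (by omega)]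
  · rwa [abs_of_pos (by omega)]
  · have : 1 < φ / x := by rwa [lt_div_iff₀ hx0, one_mul]
    linarith
  · have : φ / x < n - 1 - d := by rwa [div_lt_iff₀ hx0]
    linarith

end Parameters

/-! ### Numerical bounds for n = 19. -/

section Bounds

lemma cos_le_of_mem {θ l u : ℝ} (hl : 0 ≤ l) (h1 : l ≤ θ) (h2 : θ ≤ u) (hu : u ≤ 1) :
    Real.cos θ ≤ 1 - l ^ 2 / 2 + u ^ 4 * (5 / 96) := by
  have hθ : |θ| = θ := abs_of_nonneg (hl.trans h1)
  have h := (abs_le.1 (Real.cos_bound (x := θ) (by rw [hθ]; linarith))).2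
  rw [hθ] at h
  have e1 : l ^ 2 ≤ θ ^ 2 := by gcongr
  have e2 : θ ^ 4 ≤ u ^ 4 := by have := hl.trans h1; gcongr
  linarith

lemma le_cos_of_le {θ u : ℝ} (h1 : 0 ≤ θ) (h2 : θ ≤ u) : 1 - u ^ 2 / 2 ≤ Real.cos θ := by
  have e1 : θ ^ 2 ≤ u ^ 2 := by gcongr
  linarith [Real.one_sub_sq_div_two_le_cos (x := θ)]

lemma sin_le_of_mem {θ l u : ℝ} (hl : 0 ≤ l) (h1 : l ≤ θ) (h2 : θ ≤ u) (hu : u ≤ 1) :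
    Real.sin θ ≤ u - l ^ 3 / 6 + u ^ 5 / 100 := by
  have hθ : |θ| = θ := abs_of_nonneg (hl.trans h1)
  have h := (abs_le.1 (Real.sin_bound (x := θ) (by rw [hθ]; linarith))).2
  rw [hθ] at h
  have e1 : l ^ 3 ≤ θ ^ 3 := by gcongr
  have e2 : θ ^ 5 ≤ u ^ 5 := by have := hl.trans h1; gcongr
  linarith

lemma le_sin_of_mem {θ l u : ℝ} (hl : 0 ≤ l) (h1 : l ≤ θ) (h2 : θ ≤ u) (hu : u ≤ 1) :
    l - u ^ 3 / 6 - u ^ 5 / 100 ≤ Real.sin θ := by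
  have hθ : |θ| = θ := abs_of_nonneg (hl.trans h1)
  have h := (abs_le.1 (Real.sin_bound (x := θ) (by rw [hθ]; linarith))).1
  rw [hθ] at h
  have e1 : θ ^ 3 ≤ u ^ 3 := by have := hl.trans h1; gcongr
  have e2 : θ ^ 5 ≤ u ^ 5 := by have := hl.trans h1; gcongr
  linarith

lemma pi_div_bounds : 0.16534 ≤ Real.pi / 19 ∧ Real.pi / 19 ≤ 0.16535 := by
  have h1 := Real.pi_gt_d4
  have h2 := Real.pi_lt_d4
  constructor
  · rw [le_div_iff₀ (by norm_num)]; norm_num at h1 ⊢; linarith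
  · rw [div_le_iff₀ (by norm_num)]; norm_num at h2 ⊢; linarith

lemma sin_pi_div_bounds : 0.16453 ≤ Real.sin (Real.pi / 19) ∧ Real.sin (Real.pi / 19) ≤ 0.16465 := by
  obtain ⟨h1, h2⟩ := pi_div_bounds
  constructor
  · refine le_trans ?_ (le_sin_of_mem (l := 0.16534) (u := 0.16535) ?_ h1 h2 ?_) <;> norm_num
  · refine le_trans (sin_le_of_mem (l := 0.16534) (u := 0.16535) ?_ h1 h2 ?_) ?_ <;> norm_num

lemma cos_pi_div_bounds : 0.9863 ≤ Real.cos (Real.pi / 19) ∧ Real.cos (Real.pi / 19) ≤ 0.9864 := by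
  obtain ⟨h1, h2⟩ := pi_div_bounds
  constructor
  · refine le_trans ?_ (le_cos_of_le (u := 0.16535) ?_ h2) <;> [norm_num; positivity]
  · refine le_trans (cos_le_of_mem (l := 0.16534) (u := 0.16535) ?_ h1 h2 ?_) ?_ <;> norm_num

/-- Bounds for the sine and cosine of `7π/19`, and for the cosine of `11π/19`. -/
lemma seven_bounds : 0.913 ≤ Real.sin (7 * (Real.pi / 19)) ∧ Real.sin (7 * (Real.pi / 19)) ≤ 0.9165 ∧
    0.399 ≤ Real.cos (7 * (Real.pi / 19)) ∧ Real.cos (7 * (Real.pi / 19)) ≤ 0.405 ∧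
    Real.cos (11 * (Real.pi / 19)) ≤ -0.244 := by
  obtain ⟨h1, h2⟩ := pi_div_bounds
  have e1 : Real.sin (7 * (Real.pi / 19)) = Real.cos (5 / 2 * (Real.pi / 19)) := by
    rw [← Real.cos_pi_div_two_sub]; congr 1; ring
  have e2 : Real.cos (7 * (Real.pi / 19)) = Real.sin (5 / 2 * (Real.pi / 19)) := by
    rw [← Real.sin_pi_div_two_sub]; congr 1; ring
  have e3 : Real.cos (11 * (Real.pi / 19)) = -Real.sin (3 / 2 * (Real.pi / 19)) := by
    rw [← Real.cos_add_pi_div_two]; congr 1; ring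
  rw [e1, e2, e3]
  have a1 : 0.41335 ≤ 5 / 2 * (Real.pi / 19) := by norm_num at h1 ⊢; linarith
  have a2 : 5 / 2 * (Real.pi / 19) ≤ 0.413375 := by norm_num at h2 ⊢; linarith
  have b1 : 0.24801 ≤ 3 / 2 * (Real.pi / 19) := by norm_num at h1 ⊢; linarith
  have b2 : 3 / 2 * (Real.pi / 19) ≤ 0.248025 := by norm_num at h2 ⊢; linarith
  refine ⟨?_, ?_, ?_, ?_, neg_le_neg ?_⟩
  · refine le_trans ?_ (le_cos_of_le (u := 0.413375) ?_ a2) <;> [norm_num; positivity]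
  · refine le_trans (cos_le_of_mem (l := 0.41335) (u := 0.413375) ?_ a1 a2 ?_) ?_ <;> norm_num
  · refine le_trans ?_ (le_sin_of_mem (l := 0.41335) (u := 0.413375) ?_ a1 a2 ?_) <;> norm_num
  · refine le_trans (sin_le_of_mem (l := 0.41335) (u := 0.413375) ?_ a1 a2 ?_) ?_ <;> norm_num
  · refine le_trans ?_ (le_sin_of_mem (l := 0.24801) (u := 0.248025) ?_ b1 b2 ?_) <;> norm_num

/-- Bounds for the sine and cosine of `13π/19`, and for the cosine of `5π/19`. -/
lemma thirteen_bounds :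
    0.8355 ≤ Real.sin (13 * (Real.pi / 19)) ∧ Real.sin (13 * (Real.pi / 19)) ≤ 0.839 ∧
    -0.549 ≤ Real.cos (13 * (Real.pi / 19)) ∧
    0 ≤ Real.cos (5 * (Real.pi / 19)) ∧ Real.cos (5 * (Real.pi / 19)) ≤ 0.68 := by
  obtain ⟨h1, h2⟩ := pi_div_bounds
  -- As 13π/19 = π/2 + 7π/38, halving 7π/38 makes the Taylor bounds sharp enough; the quadratic
  -- lower bound for cos(7π/38) alone would be too weak.
  have e1 : Real.sin (13 * (Real.pi / 19)) = 2 * Real.cos (7 / 4 * (Real.pi / 19)) ^ 2 - 1 := by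
    rw [← Real.cos_two_mul, ← Real.cos_sub_pi_div_two]; congr 1; ring
  have e2 : Real.cos (13 * (Real.pi / 19)) =
      -(2 * Real.sin (7 / 4 * (Real.pi / 19)) * Real.cos (7 / 4 * (Real.pi / 19))) := by
    rw [← Real.sin_two_mul, ← Real.cos_add_pi_div_two]; congr 1; ring
  have e3 : Real.cos (5 * (Real.pi / 19)) = 2 * Real.cos (5 / 2 * (Real.pi / 19)) ^ 2 - 1 := by
    rw [← Real.cos_two_mul]; congr 1; ring
  have a1 : 0.41335 ≤ 5 / 2 * (Real.pi / 19) := by norm_num at h1 ⊢; linarith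
  have a2 : 5 / 2 * (Real.pi / 19) ≤ 0.413375 := by norm_num at h2 ⊢; linarith
  have b1 : 0.289345 ≤ 7 / 4 * (Real.pi / 19) := by norm_num at h1 ⊢; linarith
  have b2 : 7 / 4 * (Real.pi / 19) ≤ 0.2893625 := by norm_num at h2 ⊢; linarith
  have c1 : 0.958 ≤ Real.cos (7 / 4 * (Real.pi / 19)) := by
    refine le_trans ?_ (le_cos_of_le (u := 0.2893625) ?_ b2) <;> [norm_num; positivity]
  have c2 : Real.cos (7 / 4 * (Real.pi / 19)) ≤ 0.9586 := by
    refine le_trans (cos_le_of_mem (l := 0.289345) (u := 0.2893625) ?_ b1 b2 ?_) ?_ <;> norm_num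
  have s2 : Real.sin (7 / 4 * (Real.pi / 19)) ≤ 0.2858 := by
    refine le_trans (sin_le_of_mem (l := 0.289345) (u := 0.2893625) ?_ b1 b2 ?_) ?_ <;> norm_num
  have d1 : 0.914 ≤ Real.cos (5 / 2 * (Real.pi / 19)) := by
    refine le_trans ?_ (le_cos_of_le (u := 0.413375) ?_ a2) <;> [norm_num; positivity]
  have d2 : Real.cos (5 / 2 * (Real.pi / 19)) ≤ 0.9162 := by
    refine le_trans (cos_le_of_mem (l := 0.41335) (u := 0.413375) ?_ a1 a2 ?_) ?_ <;> norm_num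
  rw [e1, e2, e3]
  norm_num at c1 c2 s2 d1 d2 ⊢
  refine ⟨?_, ?_, ?_, ?_, ?_⟩ <;> nlinarith

/-- Here C = (2/19) cos(π/19), and the arc is replaced by the larger circle of radius 2/19 about
2/19. The line has intercept tan(π/19)/19 and slope cot(2π/19). The bound 0.0029 lies just above
(2/19) sin²(π/19), where a reaches d + 1. -/
lemma exists_parameters_two {X Y : ℝ} (h1 : 0.0029 ≤ X) (h2 : X ≤ 0.14)
    (hlin : 0.0089 + 2.93 * X < Y) (harc : 4 / 19 * X < X ^ 2 + Y ^ 2) :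
    ∃ a h : ℝ, Admissible 19 2 a h ∧ X = modulusRe 19 2 a ∧ Y = modulusIm 19 2 a h := by
  obtain ⟨s1, s2⟩ := sin_pi_div_bounds
  obtain ⟨c1, c2⟩ := cos_pi_div_bounds
  obtain ⟨x1, x2⟩ := pi_div_bounds
  have h16 : Real.cos (16 * (Real.pi / 19)) ≤ -0.8 := by
    have e : Real.cos (16 * (Real.pi / 19)) = -Real.cos (3 * (Real.pi / 19)) := by
      rw [← Real.cos_pi_sub]; congr 1; ring
    have := le_cos_of_le (θ := 3 * (Real.pi / 19)) (u := 0.5) (by positivity)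
      (by norm_num at x2 ⊢; linarith)
    rw [e]
    norm_num at this ⊢
    linarith
  have hsq := Real.sin_sq_add_cos_sq (Real.pi / 19)
  norm_num at s1 s2 c1 c2 h16 h1 h2 hlin
  set s := Real.sin (Real.pi / 19) with hs
  set c := Real.cos (Real.pi / 19) with hc
  have e1 : Real.sin (2 * (Real.pi / 19)) = 2 * s * c := Real.sin_two_mul _
  have e2 : Real.cos (2 * (Real.pi / 19)) = 2 * c ^ 2 - 1 := Real.cos_two_mul _
  have hs0 : s ≠ 0 := by positivity
  have hc0 : c ≠ 0 := by positivity
  refine exists_parameters (C := 2 / 19 * c) (by norm_num) (by norm_num) (by norm_num) ?_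
    (by linarith) ?_ ?_ ?_ ?_
  · push_cast
    rw [← hs, e1]
    field_simp
  · push_cast
    rw [← hc]
    have : 0.9728 ≤ c ^ 2 := by norm_num; nlinarith
    norm_num at this
    nlinarith
  · push_cast
    rw [show (19 : ℝ) - 1 - 2 = 16 by norm_num]
    nlinarith
  · push_cast
    rw [← hs, ← hc, e1, e2]
    have e : c / (19 * s) - (2 / 19 - X) * ((2 * c ^ 2 - 1) / (2 * s * c)) =
        s / (19 * c) + X * ((2 * c ^ 2 - 1) / (2 * s * c)) := by
      have : s ^ 2 = 1 - c ^ 2 := by linarith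
      field_simp
      rw [this]
      ring
    rw [e]
    have b1 : s / (19 * c) ≤ 0.0089 := by
      rw [div_le_iff₀ (by positivity)]; norm_num; linarith
    have b2 : (2 * c ^ 2 - 1) / (2 * s * c) ≤ 2.93 := by
      rw [div_le_iff₀ (by positivity)]; norm_num; nlinarith
    norm_num at b1 b2
    nlinarith
  · push_cast
    have : c ^ 2 ≤ 1 := by nlinarith
    nlinarith

/-- The constants round outward: C lies between 0.29 and 0.294, cot(7π/19) is below 0.45, and 0.09
exceeds C². -/
lemma exists_parameters_seven {X Y : ℝ} (h1 : 0.09 ≤ X) (h2 : X ≤ 0.432)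
    (hlin : 0.16 + 0.45 * X < Y) (harc : 0.09 < (7 / 19 - X) ^ 2 + Y ^ 2) :
    ∃ a h : ℝ, Admissible 19 7 a h ∧ X = modulusRe 19 7 a ∧ Y = modulusIm 19 7 a h := by
  obtain ⟨s1, s2⟩ := sin_pi_div_bounds
  obtain ⟨c1, c2⟩ := cos_pi_div_bounds
  obtain ⟨a1, a2, a3, a4, a5⟩ := seven_bounds
  norm_num at s1 s2 c1 c2 a1 a2 a3 a4 a5 h1 h2 hlin harc
  set s := Real.sin (Real.pi / 19) with hs
  set c := Real.cos (Real.pi / 19) with hc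
  set S := Real.sin (7 * (Real.pi / 19)) with hS
  set K := Real.cos (7 * (Real.pi / 19)) with hK
  have C1 : 0.29 ≤ S / (19 * s) := by
    rw [le_div_iff₀ (by positivity)]; norm_num; linarith
  have C2 : S / (19 * s) ≤ 0.294 := by
    rw [div_le_iff₀ (by positivity)]; norm_num; linarith
  norm_num at C1 C2
  refine exists_parameters (C := S / (19 * s)) (by norm_num) (by norm_num) (by norm_num) ?_
    (by linarith) ?_ ?_ ?_ ?_
  · push_cast
    rfl
  · push_cast
    rw [← hc]
    nlinarith
  · push_cast
    rw [show (19 : ℝ) - 1 - 7 = 11 by norm_num]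
    nlinarith
  · push_cast
    rw [← hs, ← hc, ← hS, ← hK]
    have b1 : c / (19 * s) ≤ 0.316 := by
      rw [div_le_iff₀ (by positivity)]; norm_num; linarith
    have b2 : K / S ≤ 0.45 := by
      rw [div_le_iff₀ (by positivity)]; norm_num; linarith
    have b3 : 0.43 ≤ K / S := by
      rw [le_div_iff₀ (by positivity)]; norm_num; linarith
    norm_num at b1 b2 b3
    nlinarith
  · push_cast
    nlinarith

/-- Now cot(13π/19) is negative and at least -0.66, and 0.0725 exceeds C². -/
lemma exists_parameters_thirteen {X Y : ℝ} (h1 : 0.425 ≤ X) (h2 : X ≤ 0.5)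
    (hlin : 0.316 + 0.66 * (13 / 19 - X) < Y) (harc : 0.0725 < (13 / 19 - X) ^ 2 + Y ^ 2) :
    ∃ a h : ℝ, Admissible 19 13 a h ∧ X = modulusRe 19 13 a ∧ Y = modulusIm 19 13 a h := by
  obtain ⟨s1, s2⟩ := sin_pi_div_bounds
  obtain ⟨c1, c2⟩ := cos_pi_div_bounds
  obtain ⟨a1, a2, a3, a4, a5⟩ := thirteen_bounds
  norm_num at s1 s2 c1 c2 a1 a2 a3 a4 a5 h1 h2 hlin harc
  set s := Real.sin (Real.pi / 19) with hs
  set c := Real.cos (Real.pi / 19) with hc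
  set S := Real.sin (13 * (Real.pi / 19)) with hS
  set K := Real.cos (13 * (Real.pi / 19)) with hK
  have C1 : 0.2665 ≤ S / (19 * s) := by
    rw [le_div_iff₀ (by positivity)]; norm_num; linarith
  have C2 : S / (19 * s) ≤ 0.2685 := by
    rw [div_le_iff₀ (by positivity)]; norm_num; linarith
  norm_num at C1 C2
  refine exists_parameters (C := S / (19 * s)) (by norm_num) (by norm_num) (by norm_num) ?_
    (by linarith) ?_ ?_ ?_ ?_
  · push_cast
    rfl
  · push_cast
    rw [← hc]
    nlinarith
  · push_cast
    rw [show (19 : ℝ) - 1 - 13 = 5 by norm_num]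
    nlinarith
  · push_cast
    rw [← hs, ← hc, ← hS, ← hK]
    have b1 : c / (19 * s) ≤ 0.316 := by
      rw [div_le_iff₀ (by positivity)]; norm_num; linarith
    have b2 : -0.66 ≤ K / S := by
      rw [le_div_iff₀ (by positivity)]; norm_num; linarith
    norm_num at b1 b2
    nlinarith
  · push_cast
    nlinarith

end Bounds

/-! ### Covering the short moduli. -/

/-- The modular transformation `z ↦ -1 / (z - N)`. -/
def invSub (N : ℤ) : SL(2, ℤ) := ⟨!![0, -1; 1, -N], by simp⟩

lemma invSub_smul (N : ℤ) (τ : ℍ) :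
    (invSub N • τ).re = (N - τ.re) / ((N - τ.re) ^ 2 + τ.im ^ 2) ∧
      (invSub N • τ).im = τ.im / ((N - τ.re) ^ 2 + τ.im ^ 2) := by
  have h := UpperHalfPlane.coe_specialLinearGroup_apply (invSub N) τ
  simp only [invSub, Matrix.SpecialLinearGroup.coe_mk, Matrix.of_apply, Matrix.cons_val',
    Matrix.cons_val_zero, Matrix.cons_val_one, Matrix.cons_val_fin_one, algebraMap_int_eq,
    eq_intCast, Int.cast_zero, Int.cast_neg, Int.cast_one, Complex.ofReal_zero, zero_mul, zero_add,
    Complex.ofReal_neg, Complex.ofReal_one, one_mul, Complex.ofReal_intCast] at h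
  have e : Complex.normSq ((τ : ℂ) + -(N : ℂ)) = (N - τ.re) ^ 2 + τ.im ^ 2 := by
    rw [Complex.normSq_apply]
    simp
    ring
  constructor
  · have := congrArg Complex.re h
    rw [Complex.div_re, e] at this
    rw [← UpperHalfPlane.coe_re]
    refine this.trans ?_
    simp
    ring
  · have := congrArg Complex.im h
    rw [Complex.div_im, e] at this
    rw [← UpperHalfPlane.coe_im]
    refine this.trans ?_
    simp
    ring

/-- The conditions on a point `X + i Y` of the upper half-plane used to find a diplotorus with
`n = 19` and this modulus. -/
def Reachable (X Y : ℝ) : Prop :=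
  (0.0029 ≤ X ∧ X ≤ 0.14 ∧ 0.0089 + 2.93 * X < Y ∧ 4 / 19 * X < X ^ 2 + Y ^ 2) ∨
  (0.09 ≤ X ∧ X ≤ 0.432 ∧ 0.16 + 0.45 * X < Y ∧ 0.09 < (7 / 19 - X) ^ 2 + Y ^ 2) ∨
  (0.425 ≤ X ∧ X ≤ 0.5 ∧ 0.316 + 0.66 * (13 / 19 - X) < Y ∧ 0.0725 < (13 / 19 - X) ^ 2 + Y ^ 2)

/-- The hypotheses force y ≥ √3/2 > 0.86, above the three lower boundaries. The cuts 0.1 and 0.43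
lie in the overlaps of the ranges of X. -/
lemma reachable_of_one_le {x y : ℝ} (h1 : 0.003 ≤ x) (h2 : x ≤ 1 / 2) (hy : 0 < y)
    (h : 1 ≤ x ^ 2 + y ^ 2) : Reachable x y := by
  have hy1 : 0.86 ≤ y := by
    by_contra hlt
    norm_num at hlt h1
    nlinarith
  norm_num at h1 hy1
  rcases le_total x 0.1 with hx | hx
  · norm_num at hx
    exact Or.inl ⟨by norm_num; linarith, by norm_num; linarith, by norm_num; linarith,
      by nlinarith⟩
  rcases le_total x 0.43 with hx' | hx'
  · norm_num at hx hx'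
    exact Or.inr (Or.inl ⟨by norm_num; linarith, by norm_num; linarith, by norm_num; linarith,
      by norm_num; nlinarith [sq_nonneg (7 / 19 - x)]⟩)
  · norm_num at hx hx'
    exact Or.inr (Or.inr ⟨by norm_num; linarith, by norm_num; linarith, by norm_num; linarith,
      by norm_num; nlinarith [sq_nonneg (13 / 19 - x)]⟩)

/-- Here w = 1 - Re τ, and 2w ≤ w² + y² is |τ| ≥ 1, which keeps X at most 1/2. At the cuts y = 1.15
and y = 3.08 the value of X is about 0.43 and 0.095, in the overlaps of the ranges of X. -/
lemma reachable_div_of_le_seventeen {w y : ℝ} (h1 : 0.997 ≤ w) (h2 : w ≤ 1) (hy : 0.99 ≤ y)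
    (hy' : y ≤ 17) (h : 2 * w ≤ w ^ 2 + y ^ 2) :
    Reachable (w / (w ^ 2 + y ^ 2)) (y / (w ^ 2 + y ^ 2)) := by
  norm_num at h1 hy
  have hw0 : 0 < w := by linarith
  obtain ⟨D, hD⟩ : ∃ D, w ^ 2 + y ^ 2 = D := ⟨_, rfl⟩
  have hD0 : 0 < D := by rw [← hD]; positivity
  have hDy : D ≤ 1 + y ^ 2 := by nlinarith
  have hDy' : 0.994 + y ^ 2 ≤ D := by norm_num; nlinarith
  norm_num at hDy'
  rw [hD] at h ⊢
  obtain ⟨X, hX⟩ : ∃ X, w / D = X := ⟨_, rfl⟩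
  obtain ⟨Y, hY⟩ : ∃ Y, y / D = Y := ⟨_, rfl⟩
  rw [hX, hY]
  have hXD : X * D = w := by rw [← hX, div_mul_cancel₀ _ hD0.ne']
  have hX0 : 0 < X := by rw [← hX]; positivity
  -- X² + Y² = 1/D and w ≤ 1; this settles the circle conditions.
  have hXY : X ≤ X ^ 2 + Y ^ 2 := by
    rw [← hX, ← hY, div_pow, div_pow, ← add_div, hD, pow_two, div_self_mul_self', div_le_iff₀ hD0,
      inv_mul_cancel₀ hD0.ne']
    exact h2
  have hlo : ∀ c, c * D ≤ w → c ≤ X := fun c hc => by rwa [← hX, le_div_iff₀ hD0]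
  have hhi : ∀ c, w ≤ c * D → X ≤ c := fun c hc => by rwa [← hX, div_le_iff₀ hD0]
  have hlin : ∀ α β, α * D + β * w < y → α + β * X < Y := fun α β hc => by
    rw [← hY, lt_div_iff₀ hD0]
    linear_combination hc + β * hXD
  rcases le_total y 1.15 with hy1 | hy1
  · norm_num at hy1
    refine Or.inr (Or.inr ⟨hlo _ ?_, hhi _ ?_, ?_, ?_⟩)
    · norm_num; nlinarith
    · norm_num; linarith
    · have := hlin (0.316 + 0.66 * (13 / 19)) (-0.66) (by norm_num; nlinarith)
      linarith
    · have := hhi 0.5 (by norm_num; linarith)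
      norm_num at this ⊢
      nlinarith
  rcases le_total y 3.08 with hy2 | hy2
  · norm_num at hy1 hy2
    refine Or.inr (Or.inl ⟨hlo _ ?_, hhi _ ?_, hlin _ _ ?_, ?_⟩)
    · norm_num; nlinarith
    · norm_num; nlinarith
    · norm_num; nlinarith
    · norm_num; nlinarith
  · norm_num at hy2
    refine Or.inl ⟨hlo _ ?_, hhi _ ?_, hlin _ _ ?_, ?_⟩
    · norm_num; nlinarith
    · norm_num; nlinarith
    · norm_num; nlinarith
    · linarith

/-- Here w = 4 - Re τ. Inversion turns the circle condition for d = 2 into w < 19/4, which w ≤ 4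
satisfies, and y ≤ 33 keeps X above 0.0029. -/
lemma reachable_div_of_seventeen_le {w y : ℝ} (h1 : 3.997 ≤ w) (h2 : w ≤ 4) (hy : 17 ≤ y)
    (hy' : y ≤ 33) : Reachable (w / (w ^ 2 + y ^ 2)) (y / (w ^ 2 + y ^ 2)) := by
  norm_num at h1
  have hw0 : 0 < w := by linarith
  obtain ⟨D, hD⟩ : ∃ D, w ^ 2 + y ^ 2 = D := ⟨_, rfl⟩
  have hD0 : 0 < D := by rw [← hD]; positivity
  have hDy : D ≤ 16 + y ^ 2 := by nlinarith
  have hDy' : y ^ 2 ≤ D := by nlinarith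
  rw [hD]
  obtain ⟨X, hX⟩ : ∃ X, w / D = X := ⟨_, rfl⟩
  obtain ⟨Y, hY⟩ : ∃ Y, y / D = Y := ⟨_, rfl⟩
  rw [hX, hY]
  have hXD : X * D = w := by rw [← hX, div_mul_cancel₀ _ hD0.ne']
  have hX0 : 0 < X := by rw [← hX]; positivity
  have hXY : X ≤ 4 * (X ^ 2 + Y ^ 2) := by
    rw [← hX, ← hY, div_pow, div_pow, ← add_div, hD, pow_two, div_self_mul_self', div_le_iff₀ hD0,
      mul_assoc, inv_mul_cancel₀ hD0.ne']
    linarith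
  refine Or.inl ⟨?_, ?_, ?_, by linarith⟩
  · rw [← hX, le_div_iff₀ hD0]
    norm_num; nlinarith
  · rw [← hX, div_le_iff₀ hD0]
    norm_num; nlinarith
  · rw [← hY, lt_div_iff₀ hD0]
    have : 0.0089 * D + 2.93 * w < y := by norm_num; nlinarith
    linear_combination this + 2.93 * hXD

/-- Every modulus of a short torus is equivalent to the modulus of a diplotorus with `n = 19`. -/
lemma exists_admissible_of_mem {τ : ℍ} (hτ : τ ∈ shortModuliPos) :
    ∃ d : ℤ, (d = 2 ∨ d = 7 ∨ d = 13) ∧ ∃ a h : ℝ, Admissible 19 d a h ∧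
      ∃ g : SL(2, ℤ), (g • τ).re = modulusRe 19 d a ∧ (g • τ).im = modulusIm 19 d a h := by
  obtain ⟨h1, h2, h3, h4⟩ := hτ
  have hy0 := τ.im_pos
  rw [abs_of_nonneg h4] at h2
  rw [abs_of_pos hy0] at h3
  have hsq : 1 ≤ τ.re ^ 2 + τ.im ^ 2 := by
    have := one_le_pow₀ h1 (n := 2)
    rwa [sq_norm_eq, UpperHalfPlane.coe_re, UpperHalfPlane.coe_im] at this
  obtain ⟨g, hg⟩ : ∃ g : SL(2, ℤ), Reachable (g • τ).re (g • τ).im := by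
    -- The case d = 2 needs X ≥ 0.0029, so moduli near the imaginary axis must be moved first. The
    -- shift by 1 would bring X below this bound for large imaginary part, hence the shift by 4
    -- beyond 17.
    rcases le_total 0.003 τ.re with hx | hx
    · exact ⟨1, by rw [one_smul]; exact reachable_of_one_le hx h2 hy0 hsq⟩
    norm_num at hx
    rcases le_total τ.im 17 with hy | hy
    · refine ⟨invSub 1, ?_⟩
      rw [(invSub_smul 1 τ).1, (invSub_smul 1 τ).2]
      push_cast
      refine reachable_div_of_le_seventeen ?_ (by linarith) ?_ hy (by nlinarith)
      · norm_num; linarith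
      · by_contra hlt
        norm_num at hlt
        nlinarith
    · refine ⟨invSub 4, ?_⟩
      rw [(invSub_smul 4 τ).1, (invSub_smul 4 τ).2]
      push_cast
      refine reachable_div_of_seventeen_le ?_ (by linarith) hy h3
      norm_num; linarith
  rcases hg with ⟨i1, i2, i3, i4⟩ | ⟨i1, i2, i3, i4⟩ | ⟨i1, i2, i3, i4⟩
  · obtain ⟨a, h, hadm, e1, e2⟩ := exists_parameters_two i1 i2 i3 i4
    exact ⟨2, by simp, a, h, hadm, g, e1, e2⟩
  · obtain ⟨a, h, hadm, e1, e2⟩ := exists_parameters_seven i1 i2 i3 i4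
    exact ⟨7, by simp, a, h, hadm, g, e1, e2⟩
  · obtain ⟨a, h, hadm, e1, e2⟩ := exists_parameters_thirteen i1 i2 i3 i4
    exact ⟨13, by simp, a, h, hadm, g, e1, e2⟩

end

end Diplotorus

theorem mainTheorem4 (τ : ℍ) (hτ : τ ∈ Diplotorus.shortModuliPos) :
    ∃ d : ℤ, (d = 2 ∨ d = 7 ∨ d = 13) ∧
      ∃ a h : ℝ, Diplotorus.Admissible 19 d a h ∧
        (∃ g : SL(2, ℤ), (g • τ).re = Diplotorus.modulusRe 19 d a ∧
          (g • τ).im = Diplotorus.modulusIm 19 d a h) ∧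
        Diplotorus.IsRealizedBy τ (Diplotorus.diplotorus 19 d a h) := by
  obtain ⟨d, hd, a, h, hadm, g, hre, him⟩ := Diplotorus.exists_admissible_of_mem hτ
  refine ⟨d, hd, a, h, hadm, ⟨g, hre, him⟩, ?_⟩
  exact Diplotorus.isRealizedBy_diplotorus (by omega) hadm g hre him
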